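/- Let $\mathbb F$ be a finite field with $q$ elements (for $q$ prime, identify $\mathbb F$ with $\{0,\dots,q-1\}$). *Circuits.* An algebraic circuit over $\mathbb F$ is a finite directed acyclic graph without parallel edges and with a distinguished output node. Nodes of in-degree zero are labelled by variables or scalars. All other nodes are $+$ gates (computing a linear combination of their children, with coefficients written on the edges) or $\times$ gates, of unbounded fan-in. The size $|C|$ is the number of nodes, the depth is the length of a longest directed path, and $\widehat C$ is the polynomial computed at the output node. An *IPS refutation* of equations $\{f_j(\bar x)=0\}_j$ is an algebraic circuit $R(\bar x,\bar y,\bar z)$ with $\widehat R(\bar x,\bar 0,\bar 0)=0$ and $\widehat R(\bar x,(f_j(\bar x))_j,(x_i^2-x_i)_i)=1$ as polynomial identities; its size and depth are those of $R$. *CNF encoding.* Let $\{C_j(\bar x)\}_{j\le m}$ be a finite set of circuits. Its variables are the unary bits $x_{g,a}$ ($a\in\mathbb F$) of: each input variable $x_i$ (shared by all circuits), each gate $g$ of each $C_j$, and extension variables $v^g_k$. A clause $\bigvee_{i\in P}x_i\vee\bigvee_{i\in N}\neg x_i$ is written as the equation $\prod_{i\in P}(1-x_i)\prod_{i\in N}x_i=0$.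 The encoding $\{\mathrm{CNF}(C_j(\bar x)=0)\}_j$ consists of: 1. for every variable $x_i$ labelling a node, clauses $\bigvee_a x_{x_i,a}$ and $\neg x_{x_i,a}\vee\neg x_{x_i,b}$ ($a\ne b$); 2. for every gate $g$ with operation $\circ$ and children $u_1,\dots,u_t$, for each of the equations $u_1\circ u_2=v^g_1$, $u_{k+2}\circ v^g_k=v^g_{k+1}$ ($1\le k\le t-3$), $u_t\circ v^g_{t-2}=g$ (for $t=2$ just $u_1\circ u_2=g$; for $t=1$ the equation that $g$ equals its child; at $+$ gates each child is multiplied by its edge coefficient), a CNF in the unary bits of the three quantities that is satisfied exactly when each of them has exactly one bit equal to $1$ and the encoded values satisfy the equation. This CNF is an arbitrary one with this property, fixed for each truth table; unary bits of scalar nodes are replaced by the corresponding constants $0,1$; 3. the axioms $x_{g,a}^2-x_{g,a}=0$ for all unary bits; 4. for the output node $o_j$ of each $C_j$: $x_{o_j,0}=1$ and $x_{o_j,a}=0$ for $a\neq 0$. **Statement.** There are a constant $c\in\mathbb N$ and a polynomial $p$ with natural number coefficients, depending only on $\mathbb F$, such that both of the following hold. Write $|C|=\sum_j|C_j|$. (i)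 Let $\Delta\ge1$ and let $\{C_j(\bar x)\}_{j\le m}$ be circuits over $\mathbb F$ of depth at most $\Delta$. For all $S,D\in\mathbb N$: if $\{C_j(\bar x)=0\}_j$ has no IPS refutation of size at most $S$ and depth at most $D+c\Delta$, then $\{\mathrm{CNF}(C_j(\bar x)=0)\}_j$ has no IPS refutation of size at most $S-p(|C|)$ and depth at most $D$. (ii) Consequently, as long as $\Delta=O(\Delta')$, hardness in depth $O(\Delta')$ for the circuit equations gives hardness in depth $O(\Delta'+\Delta)$ for the CNFs: for all $b,k\in\mathbb N$ there is $a\in\mathbb N$ such that for all $\Delta'\ge1$, $\Delta\le k\Delta'$, all circuits $\{C_j(\bar x)\}_{j\le m}$ of depth at most $\Delta$ and all $S\in\mathbb N$: if $\{C_j(\bar x)=0\}_j$ has no IPS refutation of size at most $S$ and depth at most $a\Delta'$, then $\{\mathrm{CNF}(C_j(\bar x)=0)\}_j$ has no IPS refutation of size at most $S-p(|C|)$ and depth at most $b(\Delta'+\Delta)$. -/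

import Mathlib

/-! ### Algebraic circuits -/

/-- The label of node number `i` of an algebraic circuit over `F` in the variables `X`, together
with the incoming edges, which come from nodes of smaller number (a topological order).
Input nodes carry a variable or a scalar; an addition gate has a scalar `w u` on the edge from
each child `u`.  Fan-in is unbounded and positive, and there are no parallel edges. -/
inductive AlgGate (F X : Type*) (i : ℕ) where
  | var (x : X) : AlgGate F X i
  | const (a : F) : AlgGate F X i
  | add (children : List (Fin i)) (nonempty : children ≠ []) (nodup : children.Nodup)
      (w : Fin i → F) : AlgGate F X i
  | mul (children : List (Fin i)) (nonempty : children ≠ []) (nodup : children.Nodup) :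
      AlgGate F X i

/-- An algebraic circuit: a finite labelled directed acyclic graph with a distinguished output
node. Its size is the number of nodes. -/
structure AlgCircuit (F X : Type*) where
  size : ℕ
  gate : (i : Fin size) → AlgGate F X i
  out : Fin size

namespace AlgCircuit

variable {F X : Type*}

/-- The polynomial computed by a node. -/
noncomputable def nodePoly [CommSemiring F] (C : AlgCircuit F X) (i : Fin C.size) :
    MvPolynomial X F :=
  match C.gate i with
  | .var x => MvPolynomial.X x
  | .const a => MvPolynomial.C a
  | .add l _ _ w =>
      (l.map fun u => MvPolynomial.C (w u) * C.nodePoly ⟨u.1, u.2.trans i.2⟩).sum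
  | .mul l _ _ => (l.map fun u => C.nodePoly ⟨u.1, u.2.trans i.2⟩).prod
termination_by i.1
decreasing_by all_goals exact u.2

/-- The polynomial computed by the circuit. -/
noncomputable def poly [CommSemiring F] (C : AlgCircuit F X) : MvPolynomial X F :=
  C.nodePoly C.out

/-- The length of a longest directed path that ends in a given node. -/
def nodeDepth (C : AlgCircuit F X) (i : Fin C.size) : ℕ :=
  match C.gate i with
  | .var _ => 0
  | .const _ => 0
  | .add l _ _ _ => (l.map fun u => C.nodeDepth ⟨u.1, u.2.trans i.2⟩).foldr max 0 + 1
  | .mul l _ _ => (l.map fun u => C.nodeDepth ⟨u.1, u.2.trans i.2⟩).foldr max 0 + 1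
termination_by i.1
decreasing_by all_goals exact u.2

/-- The length of a longest directed path in the circuit. -/
def depth (C : AlgCircuit F X) : ℕ :=
  Finset.univ.sup C.nodeDepth

end AlgCircuit

/-! ### The Ideal Proof System -/

/-- The variables of an IPS proof: the variables `x` of the instance, a placeholder `y j` for each
axiom, and a placeholder `z x` for each Boolean axiom `x ^ 2 - x`. -/
inductive IPSVar (X ι : Type*) where
  | x (v : X) : IPSVar X ι
  | y (j : ι) : IPSVar X ι
  | z (v : X) : IPSVar X ι

section IPS

variable {F X ι : Type*} [CommRing F]

/-- Replace all placeholders by zero. -/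
noncomputable def ipsZeroSubst : IPSVar X ι → MvPolynomial X F
  | .x v => MvPolynomial.X v
  | .y _ => 0
  | .z _ => 0

/-- Replace all placeholders by the axioms they stand for. -/
noncomputable def ipsAxiomSubst (f : ι → MvPolynomial X F) : IPSVar X ι → MvPolynomial X F
  | .x v => MvPolynomial.X v
  | .y j => f j
  | .z v => MvPolynomial.X v ^ 2 - MvPolynomial.X v

/-- The circuit `R` is an IPS proof of `p = 0` from the axioms `f j = 0` and the Boolean axioms. -/
def IsIPSProof (f : ι → MvPolynomial X F) (p : MvPolynomial X F)
    (R : AlgCircuit F (IPSVar X ι)) : Prop :=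
  MvPolynomial.aeval ipsZeroSubst R.poly = (0 : MvPolynomial X F) ∧
    MvPolynomial.aeval (ipsAxiomSubst f) R.poly = p

/-- The equations `f j = 0` have an IPS refutation of size at most `S` and depth at most `D`. -/
def HasIPSRefutation (f : ι → MvPolynomial X F) (S D : ℕ) : Prop :=
  ∃ R : AlgCircuit F (IPSVar X ι), IsIPSProof f 1 R ∧ R.size ≤ S ∧ R.depth ≤ D

end IPS

/-! ### CNF formulas -/

/-- The clause `⋁ v ∈ pos, v ∨ ⋁ v ∈ neg, ¬ v`. -/
structure BoolClause (V : Type*) where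
  pos : Finset V
  neg : Finset V

/-- A truth assignment satisfies a clause. -/
def BoolClause.Sat {V : Type*} (κ : BoolClause V) (τ : V → Prop) : Prop :=
  (∃ v ∈ κ.pos, τ v) ∨ ∃ v ∈ κ.neg, ¬ τ v

/-- The algebraic translation `∏ v ∈ pos, (1 - v) * ∏ v ∈ neg, v` of a clause, in which each
propositional variable `v` is represented by the polynomial `s v` (a variable, or one of the
constants `0` and `1`). -/
noncomputable def BoolClause.toPoly {V Y F : Type*} [CommRing F] (κ : BoolClause V)
    (s : V → MvPolynomial Y F) : MvPolynomial Y F :=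
  (∏ v ∈ κ.pos, (1 - s v)) * ∏ v ∈ κ.neg, s v

/-! ### The CNF encoding of circuit equations -/

/-- The three places of an equation `x ∘ y = z`. -/
inductive Place where
  | x | y | z

/-- A choice, for every binary truth table `h` over `F`, of a CNF in the unary bits of `x`, `y`
and `z` (the bits of a quantity are indexed by the elements of `F`) which is satisfied precisely
when each of the three has exactly one bit equal to `1` and the values given by these bits satisfy
`h x y = z`. -/
structure TableCNF (F : Type*) where
  clauses : (F → F → F) → Set (BoolClause (Place × F))
  sat_iff : ∀ (h : F → F → F) (τ : Place × F → Prop),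
    (∀ κ ∈ clauses h, κ.Sat τ) ↔
      ∃ a b : F, (∀ c, τ (.x, c) ↔ c = a) ∧ (∀ c, τ (.y, c) ↔ c = b) ∧
        ∀ c, τ (.z, c) ↔ c = h a b

/-- The quantities that own unary-bit variables in the encoding of `m` circuits in `n` variables:
the variables `x_i` (common to all the circuits), the gates `g` of the `j`-th circuit, and the
extension variables `v_k^g`, which hold the intermediate values at such a gate. -/
inductive Wire (m n : ℕ) where
  | input (i : Fin n) : Wire m n
  | gate (j : Fin m) (g : ℕ) : Wire m n
  | ext (j : Fin m) (g k : ℕ) : Wire m n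

/-- What an equation of the encoding speaks about: a known scalar or a quantity with bits. -/
inductive Signal (F : Type*) (m n : ℕ) where
  | scalar (a : F) : Signal F m n
  | wire (w : Wire m n) : Signal F m n

open Classical in
/-- The unary bit of index `c`: a constant for a scalar, a variable otherwise. -/
noncomputable def Signal.bit {F : Type*} [CommRing F] {m n : ℕ} :
    Signal F m n → F → MvPolynomial (Wire m n × F) F
  | .scalar a, c => if c = a then 1 else 0
  | .wire w, c => MvPolynomial.X (w, c)

/-- The equation `table x y = z`. -/
structure TableEquation (F : Type*) (m n : ℕ) where
  table : F → F → F
  x : Signal F m n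
  y : Signal F m n
  z : Signal F m n

/-- The unary bits of the three quantities in an equation. -/
noncomputable def TableEquation.bits {F : Type*} [CommRing F] {m n : ℕ}
    (e : TableEquation F m n) : Place × F → MvPolynomial (Wire m n × F) F
  | (.x, c) => e.x.bit c
  | (.y, c) => e.y.bit c
  | (.z, c) => e.z.bit c

section Encoding

variable {F : Type*} {m n : ℕ}

/-- The equations `u_{i+2} ∘ v_i = v_{i+1}`, ..., `u_t ∘ v_{t-2} = g`, for the list of the
children `u_{i+2}, ..., u_t`. -/
def chainEquations {N : Type*} (step : N → F → F → F) (sig : N → Signal F m n)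
    (v : ℕ → Signal F m n) (g : Signal F m n) : ℕ → List N → List (TableEquation F m n)
  | _, [] => []
  | i, [u] => [⟨step u, sig u, v i, g⟩]
  | i, u :: u' :: us =>
      ⟨step u, sig u, v i, v (i + 1)⟩ :: chainEquations step sig v g (i + 1) (u' :: us)

/-- The equations for a gate `g` with children `u_1, ..., u_t`: `u_1 ∘ u_2 = v_1`,
`u_3 ∘ v_1 = v_2`, ..., `u_t ∘ v_{t-2} = g`. Here `first u_1 u_2` and `step u` are the tables of
`∘` (with the labels of the edges taken into account), and `only u` is the table used for a gate
with the single child `u`. -/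
def foldEquations {N : Type*} (only : N → F → F → F) (first : N → N → F → F → F)
    (step : N → F → F → F) (sig : N → Signal F m n) (v : ℕ → Signal F m n)
    (g : Signal F m n) : List N → List (TableEquation F m n)
  | [] => []
  | [u] => [⟨only u, sig u, sig u, g⟩]
  | [u₁, u₂] => [⟨first u₁ u₂, sig u₁, sig u₂, g⟩]
  | u₁ :: u₂ :: u₃ :: us =>
      ⟨first u₁ u₂, sig u₁, sig u₂, v 1⟩ :: chainEquations step sig v g 1 (u₃ :: us)

/-- How a node of the `j`-th circuit appears in the encoding. -/
def nodeSignal (j : Fin m) (C : AlgCircuit F (Fin n)) (g : Fin C.size) : Signal F m n :=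
  match C.gate g with
  | .var i => .wire (.input i)
  | .const a => .scalar a
  | .add _ _ _ _ => .wire (.gate j g)
  | .mul _ _ _ => .wire (.gate j g)

/-- The equations between the unary-bit quantities that describe a node of the `j`-th circuit. -/
def nodeEquations [CommRing F] (j : Fin m) (C : AlgCircuit F (Fin n)) (g : Fin C.size) :
    List (TableEquation F m n) :=
  match C.gate g with
  | .var _ => []
  | .const _ => []
  | .add l _ _ w =>
      foldEquations (fun u a _ => w u * a) (fun u₁ u₂ a b => w u₁ * a + w u₂ * b)
        (fun u a b => w u * a + b) (fun u => nodeSignal j C ⟨u.1, u.2.trans g.2⟩)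
        (fun k => .wire (.ext j g k)) (.wire (.gate j g)) l
  | .mul l _ _ =>
      foldEquations (fun _ a _ => a) (fun _ _ a b => a * b)
        (fun _ a b => a * b) (fun u => nodeSignal j C ⟨u.1, u.2.trans g.2⟩)
        (fun k => .wire (.ext j g k)) (.wire (.gate j g)) l

/-- The clauses which say that exactly one unary bit of the variable `x_i` is `1`. -/
def exactlyOneClauses (F : Type*) [Fintype F] (m : ℕ) {n : ℕ} (i : Fin n) :
    Set (BoolClause (Wire m n × F)) :=
  {κ | κ.neg = ∅ ∧ ∀ b, b ∈ κ.pos ↔ b.1 = .input i} ∪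
    {κ | κ.pos = ∅ ∧ ∃ a c : F, a ≠ c ∧
      ∀ b, b ∈ κ.neg ↔ b = (.input i, a) ∨ b = (.input i, c)}

/-- The plain CNF encoding of the circuit equations `C j = 0`, as a set of polynomials in the
unary-bit variables (to be equated with zero). -/
def cnfEncoding [CommRing F] [Fintype F] (φ : TableCNF F)
    (C : Fin m → AlgCircuit F (Fin n)) : Set (MvPolynomial (Wire m n × F) F) :=
  {p | ∃ (j : Fin m) (g : Fin (C j).size) (i : Fin n), (C j).gate g = .var i ∧
      ∃ κ ∈ exactlyOneClauses F m i, p = κ.toPoly MvPolynomial.X} ∪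
  {p | ∃ (j : Fin m) (g : Fin (C j).size), ∃ e ∈ nodeEquations j (C j) g,
      ∃ κ ∈ φ.clauses e.table, p = κ.toPoly e.bits} ∪
  {p | ∃ b : Wire m n × F, p = MvPolynomial.X b ^ 2 - MvPolynomial.X b} ∪
  {p | ∃ j : Fin m, p = (nodeSignal j (C j) (C j).out).bit 0 - 1} ∪
  {p | ∃ (j : Fin m) (a : F), a ≠ 0 ∧ p = (nodeSignal j (C j) (C j).out).bit a}

end Encoding

/-! The contrapositive is constructive: a refutation of the CNF is turned into one of the circuit
equations. Every wire holds a value, namely the polynomial in the input variables computed there.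
The bit of index `c` at a wire with value `p` is replaced by `1 - (p - c)^(q-1)`, which as a
function on `F` indicates `p = c`. By `HasIPSRefutation.substitute` it then suffices to derive the
substituted axioms by small shallow circuits.

An output axiom becomes a polynomial without constant term in the value of `C_j`, so the same
polynomial in the placeholder `y_j` derives it. Since all gate equations are bilinear, every other
axiom becomes `Q(p₁, p₂)` with values `p₁`, `p₂` and with `Q` from a finite list that depends only
on `F` (`finite_localAxioms`). As `Q` vanishes on `F × F`, it lies in the ideal of `X₀^q - X₀` and
`X₁^q - X₁` (`exists_eq_add_of_eval_eq_zero`), and only `p^q - p` is left to derive.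

This needs no induction over gates. In `p(x)^q - p(x^q - z(1 + x + ... + x^(q-2)))` the choice `z =
0` gives `p(x)^q - p(x^q) = 0` by Frobenius, and `z = x² - x` gives `p^q - p`. The cost is two
copies of a circuit for `p` and constant extra depth, whence depth `Δ + O(1)` and polynomial size
overall.

Sizes and depths are tracked with `Computes`, a notion of circuit that is easy to compose;
`Computes.exists_circuit` returns to genuine circuits. -/

open MvPolynomial

/-! ### Systems of circuit nodes -/

/-- Node `i` of a system with values `val` is a leaf from `B`, a scalar, or a gate over nodes of
smaller rank. -/
def IsNode {F Y I : Type*} [CommSemiring F] (B : Set (MvPolynomial Y F))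
    (val : I → MvPolynomial Y F) (rank : I → ℕ) (i : I) : Prop :=
  val i ∈ B ∨ (∃ a, val i = C a) ∨
    (∃ (s : Finset I) (w : I → F), (∀ u ∈ s, rank u < rank i) ∧
      val i = ∑ u ∈ s, C (w u) * val u) ∨
    ∃ s : Finset I, (∀ u ∈ s, rank u < rank i) ∧ val i = ∏ u ∈ s, val u

/-- The polynomials in `T` can be computed simultaneously from those in `B` with at most `n` nodes
in depth at most `d`. -/
def Computes {F Y : Type*} [CommSemiring F] (B : Set (MvPolynomial Y F)) (n d : ℕ)
    (T : Set (MvPolynomial Y F)) : Prop :=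
  ∃ (I : Type) (_ : Fintype I) (val : I → MvPolynomial Y F) (rank : I → ℕ),
    Fintype.card I ≤ n ∧ (∀ i, IsNode B val rank i) ∧ (∀ i, rank i ≤ d) ∧ T ⊆ Set.range val

section Systems

variable {F Y Y' : Type*} [CommSemiring F]

/-- Leaves are left to the hypothesis `hB` because under composition a leaf of one system turns into
a gate that reads another system. -/
theorem IsNode.map {I J : Type*} {B : Set (MvPolynomial Y F)} {B' : Set (MvPolynomial Y' F)}
    {val : I → MvPolynomial Y F} {val' : J → MvPolynomial Y' F} {rank : I → ℕ} {rank' : J → ℕ}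
    (φ : MvPolynomial Y F →ₐ[F] MvPolynomial Y' F) (e : I ↪ J)
    (hval : ∀ i, val' (e i) = φ (val i)) (hrank : ∀ i j, rank i < rank j → rank' (e i) < rank' (e j))
    {i : I} (hB : val i ∈ B → IsNode B' val' rank' (e i)) (h : IsNode B val rank i) :
    IsNode B' val' rank' (e i) := by
  classical
  rcases h with h | ⟨a, h⟩ | ⟨s, w, hs, h⟩ | ⟨s, hs, h⟩
  · exact hB h
  · refine Or.inr (Or.inl ⟨a, ?_⟩)
    rw [hval, h, ← algebraMap_eq, φ.commutes, algebraMap_eq]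
  · refine Or.inr (Or.inr (Or.inl ⟨s.map e, Function.extend e w 0, ?_, ?_⟩))
    · simpa using fun u hu => hrank _ _ (hs u hu)
    · rw [hval, h, map_sum, Finset.sum_map]
      refine Finset.sum_congr rfl fun u _ => ?_
      rw [e.injective.extend_apply, map_mul, hval, ← algebraMap_eq, φ.commutes, algebraMap_eq]
  · refine Or.inr (Or.inr (Or.inr ⟨s.map e, ?_, ?_⟩))
    · simpa using fun u hu => hrank _ _ (hs u hu)
    · rw [hval, h, map_prod, Finset.prod_map]
      exact Finset.prod_congr rfl fun u _ => (hval u).symm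

theorem IsNode.embed {I J : Type*} {B B' : Set (MvPolynomial Y F)}
    {val : I → MvPolynomial Y F} {val' : J → MvPolynomial Y F} {rank : I → ℕ} {rank' : J → ℕ}
    (e : I ↪ J) (hval : ∀ i, val' (e i) = val i)
    (hrank : ∀ i j, rank i < rank j → rank' (e i) < rank' (e j))
    {i : I} (hB : val i ∈ B → IsNode B' val' rank' (e i)) (h : IsNode B val rank i) :
    IsNode B' val' rank' (e i) :=
  h.map (AlgHom.id F _) e (by simpa using hval) hrank hB

namespace Computes

variable {B B' T T' U : Set (MvPolynomial Y F)} {n n' d d' : ℕ}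

theorem mono (h : Computes B n d T) (hB : B ⊆ B') (hn : n ≤ n') (hd : d ≤ d') (hT : T' ⊆ T) :
    Computes B' n' d' T' := by
  obtain ⟨I, _, val, rank, hI, hval, hrank, hr⟩ := h
  refine ⟨I, inferInstance, val, rank, hI.trans hn, fun i => ?_, fun i => (hrank i).trans hd,
    hT.trans hr⟩
  exact (hval i).imp_left fun h => hB h

theorem map (h : Computes B n d T) (φ : MvPolynomial Y F →ₐ[F] MvPolynomial Y' F) :
    Computes (φ '' B) n d (φ '' T) := by
  obtain ⟨I, _, val, rank, hI, hval, hrank, hr⟩ := h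
  refine ⟨I, inferInstance, φ ∘ val, rank, hI, fun i => ?_, hrank, ?_⟩
  · exact (hval i).map φ (Function.Embedding.refl I) (fun _ => rfl) (fun _ _ h => h)
      fun hi => Or.inl ⟨_, hi, rfl⟩
  · rintro _ ⟨t, ht, rfl⟩
    obtain ⟨i, rfl⟩ := hr ht
    exact ⟨i, rfl⟩

theorem empty (B : Set (MvPolynomial Y F)) (d : ℕ) : Computes B 0 d ∅ :=
  ⟨Empty, inferInstance, Empty.elim, Empty.elim, by simp, fun i => i.elim, fun i => i.elim,
    Set.empty_subset _⟩

theorem union (h : Computes B n d T) (h' : Computes B n' d T') :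
    Computes B (n + n') d (T ∪ T') := by
  obtain ⟨I, _, val, rank, hI, hval, hrank, hr⟩ := h
  obtain ⟨J, _, val', rank', hJ, hval', hrank', hr'⟩ := h'
  refine ⟨I ⊕ J, inferInstance, Sum.elim val val', Sum.elim rank rank', ?_, ?_, ?_, ?_⟩
  · rw [Fintype.card_sum]; omega
  · rintro (i | i)
    · exact (hval i).embed ⟨Sum.inl, Sum.inl_injective⟩ (fun _ => rfl) (fun _ _ h => h) Or.inl
    · exact (hval' i).embed ⟨Sum.inr, Sum.inr_injective⟩ (fun _ => rfl) (fun _ _ h => h) Or.inl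
  · rintro (i | i)
    exacts [hrank i, hrank' i]
  · rw [Set.Sum.elim_range]
    exact Set.union_subset_union hr hr'

theorem biUnion {K : Type*} (s : Finset K) {T : K → Set (MvPolynomial Y F)}
    (h : ∀ k ∈ s, Computes B n d (T k)) : Computes B (s.card * n) d (⋃ k ∈ s, T k) := by
  classical
  induction s using Finset.induction_on with
  | empty => simpa using Computes.empty B d
  | insert a s ha ih =>
    rw [Finset.card_insert_of_notMem ha, add_mul, one_mul, add_comm, Finset.set_biUnion_insert]
    exact (h a (Finset.mem_insert_self a s)).union
      (ih fun k hk => h k (Finset.mem_insert_of_mem hk))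

theorem iUnion {K : Type*} [Fintype K] {T : K → Set (MvPolynomial Y F)}
    (h : ∀ k, Computes B n d (T k)) : Computes B (Fintype.card K * n) d (⋃ k, T k) := by
  simpa using biUnion (Finset.univ : Finset K) (fun k _ => h k)

/-- A leaf of the second system becomes a sum whose only summand is a node of the first. This costs
one level of depth and no node. -/
theorem comp (h : Computes B n d T) (h' : Computes T n' d' U) :
    Computes B (n + n') (d + 1 + d') (T ∪ U) := by
  obtain ⟨I, _, val, rank, hI, hval, hrank, hr⟩ := h
  obtain ⟨J, _, val', rank', hJ, hval', hrank', hr'⟩ := h'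
  refine ⟨I ⊕ J, inferInstance, Sum.elim val val',
    Sum.elim rank fun j => d + 1 + rank' j, ?_, ?_, ?_, ?_⟩
  · rw [Fintype.card_sum]; omega
  · rintro (i | i)
    · exact (hval i).embed ⟨Sum.inl, Sum.inl_injective⟩ (fun _ => rfl) (fun _ _ h => h) Or.inl
    · refine (hval' i).embed ⟨Sum.inr, Sum.inr_injective⟩ (fun _ => rfl)
        (fun _ _ h => by simpa using h) fun hi => ?_
      obtain ⟨k, hk⟩ := hr hi
      refine Or.inr (Or.inr (Or.inl ⟨{Sum.inl k}, 1, ?_, ?_⟩))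
      · have := hrank k
        simp only [Finset.mem_singleton, forall_eq, Sum.elim_inl, Function.Embedding.coeFn_mk,
          Sum.elim_inr]
        omega
      · simp [hk]
  · rintro (i | i)
    · have := hrank i
      simp only [Sum.elim_inl]; omega
    · have := hrank' i
      simp only [Sum.elim_inr]; omega
  · rw [Set.Sum.elim_range]
    exact Set.union_subset_union hr hr'

theorem of_mem {p : MvPolynomial Y F} (h : p ∈ B) : Computes B 1 0 {p} :=
  ⟨Unit, inferInstance, fun _ => p, fun _ => 0, by simp, fun _ => Or.inl h, fun _ => le_rfl,
    by simp⟩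

theorem const (B : Set (MvPolynomial Y F)) (a : F) : Computes B 1 0 {C a} :=
  ⟨Unit, inferInstance, fun _ => C a, fun _ => 0, by simp, fun _ => Or.inr (Or.inl ⟨a, rfl⟩),
    fun _ => le_rfl, by simp⟩

theorem list_sum {N : Type*} (l : List N) (w : N → F) (f : N → MvPolynomial Y F)
    (h : ∀ u ∈ l, f u ∈ B) :
    Computes B (l.length + 1) 1 {(l.map fun u => C (w u) * f u).sum} := by
  -- One leaf per position of the list, so that repeated entries do not create parallel edges;
  -- `none` is the gate.
  refine ⟨Option (Fin l.length), inferInstance,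
    fun o => o.elim (l.map fun u => C (w u) * f u).sum fun i => f l[i],
    fun o => o.elim 1 fun _ => 0, by simp, ?_, ?_, ?_⟩
  · rintro (_ | i)
    · refine Or.inr (Or.inr (Or.inl ⟨Finset.univ.map Function.Embedding.some,
        fun o => o.elim 0 fun i => w l[i], by simp, ?_⟩))
      rw [Finset.sum_map]
      simp [← Fin.sum_univ_fun_getElem]
    · exact Or.inl (h _ (List.getElem_mem _))
  · rintro (_ | i) <;> simp
  · simpa using ⟨none, rfl⟩

theorem list_prod {N : Type*} (l : List N) (f : N → MvPolynomial Y F)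
    (h : ∀ u ∈ l, f u ∈ B) :
    Computes B (l.length + 1) 1 {(l.map f).prod} := by
  refine ⟨Option (Fin l.length), inferInstance,
    fun o => o.elim (l.map f).prod fun i => f l[i],
    fun o => o.elim 1 fun _ => 0, by simp, ?_, ?_, ?_⟩
  · rintro (_ | i)
    · refine Or.inr (Or.inr (Or.inr ⟨Finset.univ.map Function.Embedding.some, by simp, ?_⟩))
      rw [Finset.prod_map]
      simp [← Fin.prod_univ_fun_getElem]
    · exact Or.inl (h _ (List.getElem_mem _))
  · rintro (_ | i) <;> simp
  · simpa using ⟨none, rfl⟩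

end Computes

theorem exists_computes (Q : MvPolynomial Y F) :
    ∃ n d, Computes (Set.range (X : Y → MvPolynomial Y F)) n d {Q} := by
  induction Q using MvPolynomial.induction_on with
  | C a => exact ⟨_, _, .const _ a⟩
  | add p q hp hq =>
    obtain ⟨n, d, hp⟩ := hp
    obtain ⟨n', d', hq⟩ := hq
    have h := (hp.mono subset_rfl le_rfl (le_max_left d d') subset_rfl).union
      (hq.mono subset_rfl le_rfl (le_max_right d d') subset_rfl)
    refine ⟨_, _, (h.comp (.list_sum [p, q] 1 id (by simp))).mono subset_rfl le_rfl le_rfl ?_⟩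
    simp
  | mul_X p i hp =>
    obtain ⟨n, d, hp⟩ := hp
    have h := hp.union ((Computes.of_mem (Set.mem_range_self i)).mono subset_rfl le_rfl
      (Nat.zero_le d) subset_rfl)
    refine ⟨_, _, (h.comp (.list_prod [p, X i] id (by simp))).mono subset_rfl le_rfl le_rfl ?_⟩
    simp

/-- The circuit for `Q` is fixed before the substitution, which only acts on its leaves. This
uniformity is the source of the constants below. -/
theorem exists_computes_aeval (Q : MvPolynomial Y F) :
    ∃ n d, ∀ (Y' : Type) (s : Y → MvPolynomial Y' F),
      Computes (Set.range s) n d {aeval s Q} := by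
  obtain ⟨n, d, h⟩ := exists_computes Q
  refine ⟨n, d, fun Y' s => (h.map (aeval s)).mono ?_ le_rfl le_rfl (by simp)⟩
  rintro _ ⟨_, ⟨y, rfl⟩, rfl⟩
  exact ⟨y, by simp⟩

end Systems

/-! ### Systems of nodes and circuits -/

section Circuits

variable {F Y : Type*} [CommSemiring F]

theorem List.foldr_max_lt_add_one {l : List ℕ} {a : ℕ} (h : a ∈ l) :
    a < l.foldr max 0 + 1 := by
  induction l with
  | nil => simp at h
  | cons b l ih =>
    rcases List.mem_cons.1 h with rfl | h
    · simp only [List.foldr_cons]; omega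
    · have := ih h
      simp only [List.foldr_cons]; omega

theorem List.foldr_max_le {l : List ℕ} {b : ℕ} (h : ∀ a ∈ l, a ≤ b) : l.foldr max 0 ≤ b := by
  induction l with
  | nil => simp
  | cons a l ih => simp_all

theorem AlgCircuit.isNode (R : AlgCircuit F Y) (i : Fin R.size) :
    IsNode {p | ∃ (g : Fin R.size) (x : Y), R.gate g = .var x ∧ p = X x} R.nodePoly R.nodeDepth
      i := by
  classical
  rcases h : R.gate i with x | a | ⟨l, hl, hnd, w⟩ | ⟨l, hl, hnd⟩
  · exact Or.inl ⟨i, x, h, by rw [AlgCircuit.nodePoly, h]⟩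
  · exact Or.inr (Or.inl ⟨a, by rw [AlgCircuit.nodePoly, h]⟩)
  · let e : Fin i ↪ Fin R.size := Fin.castLEEmb i.2.le
    refine Or.inr (Or.inr (Or.inl ⟨l.toFinset.map e, Function.extend e w 0, ?_, ?_⟩))
    · simp only [Finset.mem_map, List.mem_toFinset, forall_exists_index, and_imp,
        forall_apply_eq_imp_iff₂]
      intro u hu
      rw [AlgCircuit.nodeDepth.eq_def R i, h]
      exact List.foldr_max_lt_add_one (List.mem_map.2 ⟨u, hu, rfl⟩)
    · rw [AlgCircuit.nodePoly, h, Finset.sum_map, List.sum_toFinset _ hnd]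
      simp only [e.injective.extend_apply]
      rfl
  · let e : Fin i ↪ Fin R.size := Fin.castLEEmb i.2.le
    refine Or.inr (Or.inr (Or.inr ⟨l.toFinset.map e, ?_, ?_⟩))
    · simp only [Finset.mem_map, List.mem_toFinset, forall_exists_index, and_imp,
        forall_apply_eq_imp_iff₂]
      intro u hu
      rw [AlgCircuit.nodeDepth.eq_def R i, h]
      exact List.foldr_max_lt_add_one (List.mem_map.2 ⟨u, hu, rfl⟩)
    · rw [AlgCircuit.nodePoly, h, Finset.prod_map, List.prod_toFinset _ hnd]
      rfl

theorem AlgCircuit.computes (R : AlgCircuit F Y) :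
    Computes {p | ∃ (g : Fin R.size) (x : Y), R.gate g = .var x ∧ p = X x} R.size R.depth
      (Set.range R.nodePoly) :=
  ⟨Fin R.size, inferInstance, R.nodePoly, R.nodeDepth, by simp, R.isNode,
    fun i => Finset.le_sup (f := R.nodeDepth) (Finset.mem_univ i), subset_rfl⟩

/-- Sorting by rank yields the topological numbering that circuits require. -/
theorem exists_equiv_fin_of_rank {I : Type*} [Fintype I] (rank : I → ℕ) :
    ∃ e : I ≃ Fin (Fintype.card I), ∀ u v, rank u < rank v → e u < e v := by
  let e₀ := Fintype.equivFin I
  refine ⟨e₀.trans (Tuple.sort (rank ∘ e₀.symm)).symm, fun u v huv => ?_⟩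
  by_contra! h
  have := Tuple.monotone_sort (rank ∘ e₀.symm) h
  simp at this
  omega

/-- The gate `G` computes the value of node `k`. -/
def AlgGate.Realizes {k : ℕ} (G : AlgGate F Y k) (val : ℕ → MvPolynomial Y F) (rank : ℕ → ℕ) :
    Prop :=
  match G with
  | .var x => val k = X x
  | .const a => val k = C a
  | .add l _ _ w => val k = (l.map fun u : Fin k => C (w u) * val u).sum ∧
      ∀ u ∈ l, rank u < rank k
  | .mul l _ _ => val k = (l.map fun u : Fin k => val u).prod ∧ ∀ u ∈ l, rank u < rank k

theorem IsNode.exists_gate {N : ℕ} {val : ℕ → MvPolynomial Y F} {rank : ℕ → ℕ}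
    (hrank : ∀ u v : Fin N, rank u < rank v → u < v) {k : Fin N}
    (h : IsNode (Set.range X) (fun i : Fin N => val i) (fun i : Fin N => rank i) k) :
    ∃ G : AlgGate F Y k, G.Realizes val rank := by
  classical
  have key (s : Finset (Fin N)) (hs : ∀ u ∈ s, rank u < rank k) :
      ∃ t : Finset (Fin k), t.map (Fin.castLEEmb k.2.le) = s := by
    refine ⟨s.attach.image fun u => ⟨u.1.1, hrank _ _ (hs _ u.2)⟩, ?_⟩
    ext u
    simp only [Finset.mem_map, Finset.mem_image, Finset.mem_attach, true_and, Subtype.exists]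
    constructor
    · rintro ⟨_, ⟨v, hv, rfl⟩, rfl⟩; exact hv
    · exact fun hu => ⟨_, ⟨u, hu, rfl⟩, rfl⟩
  rcases h with ⟨x, hx⟩ | ⟨a, h⟩ | ⟨s, w, hs, h⟩ | ⟨s, hs, h⟩
  · exact ⟨.var x, hx.symm⟩
  · exact ⟨.const a, h⟩
  · obtain ⟨t, rfl⟩ := key s hs
    simp only [Finset.sum_map] at h
    -- Gates of a circuit have positive fan-in, so an empty sum becomes a constant.
    rcases t.eq_empty_or_nonempty with rfl | ht
    · exact ⟨.const 0, by simpa [AlgGate.Realizes] using h⟩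
    · refine ⟨.add t.toList (by simpa using ht.ne_empty) t.nodup_toList
        (fun u => w (Fin.castLEEmb k.2.le u)), ?_, ?_⟩
      · rw [Finset.sum_map_toList]; exact h
      · intro u hu
        exact hs (Fin.castLEEmb k.2.le u) (Finset.mem_map_of_mem _ (Finset.mem_toList.1 hu))
  · obtain ⟨t, rfl⟩ := key s hs
    simp only [Finset.prod_map] at h
    rcases t.eq_empty_or_nonempty with rfl | ht
    · exact ⟨.const 1, by simpa [AlgGate.Realizes] using h⟩
    · refine ⟨.mul t.toList (by simpa using ht.ne_empty) t.nodup_toList, ?_, ?_⟩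
      · rw [Finset.prod_map_toList]; exact h
      · intro u hu
        exact hs (Fin.castLEEmb k.2.le u) (Finset.mem_map_of_mem _ (Finset.mem_toList.1 hu))

theorem AlgCircuit.node_of_realizes (R : AlgCircuit F Y) {val : ℕ → MvPolynomial Y F}
    {rank : ℕ → ℕ} (h : ∀ i, (R.gate i).Realizes val rank) (k : ℕ) (hk : k < R.size) :
    R.nodePoly ⟨k, hk⟩ = val k ∧ R.nodeDepth ⟨k, hk⟩ ≤ rank k := by
  induction k using Nat.strong_induction_on with
  | _ k ih =>
    have hG := h ⟨k, hk⟩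
    rw [AlgCircuit.nodePoly, AlgCircuit.nodeDepth]
    rcases hg : R.gate ⟨k, hk⟩ with x | a | ⟨l, hl, hnd, w⟩ | ⟨l, hl, hnd⟩
    · rw [hg] at hG
      exact ⟨hG.symm, Nat.zero_le _⟩
    · rw [hg] at hG
      exact ⟨hG.symm, Nat.zero_le _⟩
    · rw [hg] at hG
      refine ⟨hG.1.symm ▸ ?_, ?_⟩
      · simp only
        congr 1
        exact List.map_congr_left fun u hu => by rw [(ih u u.2 _).1]
      -- A gate has a child, so `rank k - 1` is not truncated and bounds the depths of the children.
      · have h0 : 0 < rank k := by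
          obtain ⟨u, hu⟩ := List.exists_mem_of_ne_nil l hl
          exact (Nat.zero_le _).trans_lt (hG.2 u hu)
        refine Nat.succ_le_of_lt (lt_of_le_of_lt (List.foldr_max_le (b := rank k - 1) ?_) (by omega))
        simp only [List.mem_map, forall_exists_index, and_imp, forall_apply_eq_imp_iff₂]
        intro u hu
        have h1 := (ih u u.2 (u.2.trans hk)).2
        have h2 := hG.2 u hu
        simp only at h2
        omega
    · rw [hg] at hG
      refine ⟨hG.1.symm ▸ ?_, ?_⟩
      · simp only
        congr 1
        exact List.map_congr_left fun u hu => by rw [(ih u u.2 _).1]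
      · have h0 : 0 < rank k := by
          obtain ⟨u, hu⟩ := List.exists_mem_of_ne_nil l hl
          exact (Nat.zero_le _).trans_lt (hG.2 u hu)
        refine Nat.succ_le_of_lt (lt_of_le_of_lt (List.foldr_max_le (b := rank k - 1) ?_) (by omega))
        simp only [List.mem_map, forall_exists_index, and_imp, forall_apply_eq_imp_iff₂]
        intro u hu
        have h1 := (ih u u.2 (u.2.trans hk)).2
        have h2 := hG.2 u hu
        simp only at h2
        omega

theorem Computes.exists_circuit {n d : ℕ} {p : MvPolynomial Y F}
    (h : Computes (Set.range X) n d {p}) :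
    ∃ R : AlgCircuit F Y, R.poly = p ∧ R.size ≤ n ∧ R.depth ≤ d := by
  obtain ⟨I, _, val, rank, hI, hval, hrank, hr⟩ := h
  obtain ⟨o, rfl⟩ := hr rfl
  obtain ⟨e, he⟩ := exists_equiv_fin_of_rank rank
  let val' (k : ℕ) : MvPolynomial Y F := if h : k < Fintype.card I then val (e.symm ⟨k, h⟩) else 0
  let rank' (k : ℕ) : ℕ := if h : k < Fintype.card I then rank (e.symm ⟨k, h⟩) else 0
  have hv (i : I) : val' (e i) = val i := by simp [val']
  have hrk (i : I) : rank' (e i) = rank i := by simp [rank']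
  have hgate (k : Fin (Fintype.card I)) : ∃ G : AlgGate F Y k, G.Realizes val' rank' := by
    apply IsNode.exists_gate
    · intro u v
      obtain ⟨u, rfl⟩ := e.surjective u
      obtain ⟨v, rfl⟩ := e.surjective v
      rw [hrk, hrk]
      exact he u v
    · obtain ⟨i, rfl⟩ := e.surjective k
      exact (hval i).embed e.toEmbedding hv (fun i j hij => by simpa [hrk] using hij)
        fun h => Or.inl (Set.mem_of_eq_of_mem (hv i) h)
  choose gate hgate using hgate
  let R : AlgCircuit F Y := ⟨Fintype.card I, gate, e o⟩
  refine ⟨R, ?_, hI, ?_⟩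
  · exact (R.node_of_realizes hgate _ (e o).2).1.trans (hv o)
  · refine Finset.sup_le fun k _ => ?_
    obtain ⟨i, rfl⟩ := e.surjective k
    exact (R.node_of_realizes hgate _ (e i).2).2.trans ((hrk i).trans_le (hrank i))

end Circuits

/-! ### Unary bits over a finite field -/

section Indicator

variable {F : Type*} [Field F] [Fintype F]

/-- The polynomial in `p` that takes the value `1` where `p = c` and `0` elsewhere. -/
@[irreducible] def pointIndicator {A : Type*} [CommRing A] [Algebra F A] (c : F) (p : A) : A :=
  1 - (p - algebraMap F A c) ^ (Fintype.card F - 1)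

theorem map_pointIndicator {A A' : Type*} [CommRing A] [Algebra F A] [CommRing A'] [Algebra F A']
    (φ : A →ₐ[F] A') (c : F) (p : A) : φ (pointIndicator c p) = pointIndicator c (φ p) := by
  simp [pointIndicator]

theorem pointIndicator_self (a : F) : pointIndicator a a = 1 := by
  have : Fintype.card F - 1 ≠ 0 := by have := Fintype.one_lt_card (α := F); omega
  simp [pointIndicator, this]

theorem pointIndicator_of_ne {a c : F} (h : a ≠ c) : pointIndicator c a = 0 := by
  simp [pointIndicator, FiniteField.pow_card_sub_one_eq_one _ (sub_ne_zero.2 h)]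

open Classical in
theorem pointIndicator_eq_ite (a c : F) : pointIndicator c a = if c = a then 1 else 0 := by
  split_ifs with h
  · rw [h, pointIndicator_self]
  · exact pointIndicator_of_ne (Ne.symm h)

theorem MvPolynomial.prod_X_sub_C_univ {σ : Type*} (i : σ) :
    ∏ r : F, (X i - C r : MvPolynomial σ F) = X i ^ Fintype.card F - X i := by
  have h : (Polynomial.X ^ Fintype.card F - Polynomial.X : Polynomial F) =
      ∏ r : F, (Polynomial.X - Polynomial.C r) := by
    have h1 : (Polynomial.X ^ Fintype.card F - Polynomial.X : Polynomial F).Monic := by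
      refine Polynomial.monic_X_pow_sub ?_
      simpa using Fintype.one_lt_card (α := F)
    have h2 := Polynomial.prod_multiset_X_sub_C_of_monic_of_roots_card_eq h1 (by
      rw [FiniteField.roots_X_pow_card_sub_X,
        FiniteField.X_pow_card_sub_X_natDegree_eq F Fintype.one_lt_card]
      rfl)
    rw [FiniteField.roots_X_pow_card_sub_X] at h2
    exact h2.symm
  have := congrArg (Polynomial.aeval (X i : MvPolynomial σ F)) h
  simpa [map_prod, algebraMap_eq] using this.symm

/-- On the grid `F × F` the grid polynomials of the combinatorial Nullstellensatz are `X i ^ q - X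
i`. -/
theorem exists_eq_add_of_eval_eq_zero {Q : MvPolynomial (Fin 2) F}
    (hQ : ∀ a b : F, eval ![a, b] Q = 0) :
    ∃ H₁ H₂ : MvPolynomial (Fin 2) F,
      Q = H₁ * (X 0 ^ Fintype.card F - X 0) + H₂ * (X 1 ^ Fintype.card F - X 1) := by
  obtain ⟨h, -, hh⟩ := combinatorial_nullstellensatz_exists_linearCombination
    (fun _ : Fin 2 => (Finset.univ : Finset F)) (fun _ => Finset.univ_nonempty) Q
    (fun x _ => by
      have := hQ (x 0) (x 1)
      rwa [show ![x 0, x 1] = x from by ext i; fin_cases i <;> rfl] at this)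
  refine ⟨h 0, h 1, ?_⟩
  rw [Finsupp.linearCombination_apply, Finsupp.sum_fintype _ _ (by simp)] at hh
  simpa [prod_X_sub_C_univ] using hh

end Indicator

/-! ### IPS derivations of consequences of the Boolean axioms -/

section Fermat

variable {F X ι : Type*} [Field F] [Fintype F]

/-- The inclusion of the polynomials in the variables of the instance. -/
noncomputable def ipsEmbed (F X ι : Type*) [Field F] :
    MvPolynomial X F →ₐ[F] MvPolynomial (IPSVar X ι) F :=
  aeval fun v => MvPolynomial.X (.x v)

/-- The substitution for `x` of a polynomial which becomes `x ^ q` when the placeholders are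
replaced by zero, and `x` when they are replaced by the axioms. -/
noncomputable def ipsTwist (F X ι : Type*) [Field F] [Fintype F] :
    MvPolynomial X F →ₐ[F] MvPolynomial (IPSVar X ι) F :=
  aeval fun v => MvPolynomial.X (.x v) ^ Fintype.card F - MvPolynomial.X (.z v) *
    ∑ k ∈ Finset.range (Fintype.card F - 1), MvPolynomial.X (.x v) ^ k

/-- An IPS derivation of `p ^ q - p`. -/
noncomputable def ipsFermat (p : MvPolynomial X F) : MvPolynomial (IPSVar X ι) F :=
  ipsEmbed F X ι p ^ Fintype.card F - ipsTwist F X ι p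

omit [Fintype F] in
theorem aeval_zero_ipsEmbed (p : MvPolynomial X F) :
    aeval (ipsZeroSubst (F := F)) (ipsEmbed F X ι p) = p := by
  have : (aeval (ipsZeroSubst (F := F) (ι := ι))).comp (ipsEmbed F X ι) =
      AlgHom.id F (MvPolynomial X F) := by
    ext v : 1
    simp [ipsEmbed, ipsZeroSubst]
  exact DFunLike.congr_fun this p

omit [Fintype F] in
theorem aeval_axiom_ipsEmbed (f : ι → MvPolynomial X F) (p : MvPolynomial X F) :
    aeval (ipsAxiomSubst f) (ipsEmbed F X ι p) = p := by
  have : (aeval (ipsAxiomSubst f)).comp (ipsEmbed F X ι) =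
      AlgHom.id F (MvPolynomial X F) := by
    ext v : 1
    simp [ipsEmbed, ipsAxiomSubst]
  exact DFunLike.congr_fun this p

/-- With the placeholders at zero the twist is `x ↦ x^q`; this is the Frobenius map, which fixes the
coefficients in `F`. -/
theorem aeval_zero_ipsFermat (p : MvPolynomial X F) :
    aeval (ipsZeroSubst (F := F) (ι := ι)) (ipsFermat p) = 0 := by
  have : (aeval (ipsZeroSubst (F := F) (ι := ι))).comp (ipsTwist F X ι) =
      FiniteField.frobeniusAlgHom F (MvPolynomial X F) := by
    ext v : 1
    simp [ipsTwist, ipsZeroSubst]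
  have h := DFunLike.congr_fun this p
  simp only [AlgHom.comp_apply, FiniteField.coe_frobeniusAlgHom] at h
  rw [ipsFermat, map_sub, map_pow, aeval_zero_ipsEmbed, h, sub_self]

/-- The geometric sum gives `(x² - x)(1 + ... + x^(q-2)) = x^q - x`, so the twist becomes the
identity. -/
theorem aeval_axiom_ipsFermat (f : ι → MvPolynomial X F) (p : MvPolynomial X F) :
    aeval (ipsAxiomSubst f) (ipsFermat p) = p ^ Fintype.card F - p := by
  have : (aeval (ipsAxiomSubst f)).comp (ipsTwist F X ι) = AlgHom.id F (MvPolynomial X F) := by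
    ext v : 1
    obtain ⟨n, hn⟩ : ∃ n, Fintype.card F = n + 1 := ⟨_, (Nat.succ_pred Fintype.card_ne_zero).symm⟩
    have h := geom_sum_mul (MvPolynomial.X v : MvPolynomial X F) n
    simp only [ipsTwist, ipsAxiomSubst, AlgHom.comp_apply, aeval_X, map_sub, map_pow, map_mul,
      map_sum, AlgHom.id_apply, hn, Nat.add_sub_cancel]
    linear_combination (-(MvPolynomial.X v : MvPolynomial X F)) * h
  have h := DFunLike.congr_fun this p
  simp only [AlgHom.comp_apply, AlgHom.id_apply] at h
  rw [ipsFermat, map_sub, map_pow, aeval_axiom_ipsEmbed, h]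

end Fermat

/-! ### Short derivations of polynomial identities valid on `F × F` -/

section FermatCircuits

variable {F : Type*} [Field F] [Fintype F]

/-- A polynomial that vanishes on `F × F` has short IPS derivations at all pairs of
polynomials. -/
theorem exists_computes_of_eval_eq_zero {Q : MvPolynomial (Fin 2) F}
    (hQ : ∀ a b : F, eval ![a, b] Q = 0) :
    ∃ N d, ∀ (X ι : Type) (p₁ p₂ : MvPolynomial X F), ∃ Y : MvPolynomial (IPSVar X ι) F,
      Computes {ipsEmbed F X ι p₁, ipsEmbed F X ι p₂, ipsFermat p₁, ipsFermat p₂} N d {Y} ∧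
      aeval (ipsZeroSubst (F := F)) Y = 0 ∧
      ∀ f, aeval (ipsAxiomSubst f) Y = aeval ![p₁, p₂] Q := by
  obtain ⟨H₁, H₂, rfl⟩ := exists_eq_add_of_eval_eq_zero hQ
  -- Variables 0 and 1 stand for the two polynomials, 2 and 3 for their Fermat derivations. Each
  -- summand has a factor of the latter kind, so it vanishes with the placeholders.
  obtain ⟨N, d, h⟩ := exists_computes_aeval
    (aeval ![X 0, X 1] H₁ * X 2 + aeval ![X 0, X 1] H₂ * X 3 : MvPolynomial (Fin 4) F)
  refine ⟨N, d, fun X ι p₁ p₂ => ⟨_, (h _ ![ipsEmbed F X ι p₁, ipsEmbed F X ι p₂, ipsFermat p₁,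
    ipsFermat p₂]).mono (by simp [Set.insert_subset_iff]) le_rfl le_rfl subset_rfl, ?_, ?_⟩⟩
  · simp [aeval_zero_ipsFermat, -aeval_eq_bind₁]
  · intro f
    have key (H : MvPolynomial (Fin 2) F) :
        aeval (ipsAxiomSubst f) (aeval ![ipsEmbed F X ι p₁, ipsEmbed F X ι p₂, ipsFermat p₁,
          ipsFermat p₂] (aeval ![MvPolynomial.X 0, MvPolynomial.X 1] H :
            MvPolynomial (Fin 4) F)) = aeval ![p₁, p₂] H := by
      have : ((aeval (ipsAxiomSubst f)).comp (aeval ![ipsEmbed F X ι p₁, ipsEmbed F X ι p₂,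
          ipsFermat p₁, ipsFermat p₂])).comp (aeval (R := F) ![MvPolynomial.X 0,
            MvPolynomial.X 1]) = aeval ![p₁, p₂] := by
        ext i : 1
        fin_cases i <;> simp [aeval_axiom_ipsEmbed, -aeval_eq_bind₁]
      exact DFunLike.congr_fun this H
    simp only [map_add, map_mul, aeval_X, key]
    simp [aeval_axiom_ipsFermat, -aeval_eq_bind₁]

/-- Uniform bounds for a finite family in `exists_computes_of_eval_eq_zero`. -/
theorem exists_computes_of_finite {s : Set (MvPolynomial (Fin 2) F)} (hs : s.Finite)
    (hQ : ∀ Q ∈ s, ∀ a b : F, eval ![a, b] Q = 0) :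
    ∃ N d, ∀ Q ∈ s, ∀ (X ι : Type) (p₁ p₂ : MvPolynomial X F),
      ∃ Y : MvPolynomial (IPSVar X ι) F,
      Computes {ipsEmbed F X ι p₁, ipsEmbed F X ι p₂, ipsFermat p₁, ipsFermat p₂} N d {Y} ∧
      aeval (ipsZeroSubst (F := F)) Y = 0 ∧
      ∀ f, aeval (ipsAxiomSubst f) Y = aeval ![p₁, p₂] Q := by
  choose! N d h using fun Q (h : Q ∈ s) => exists_computes_of_eval_eq_zero (hQ Q h)
  obtain ⟨N', hN⟩ := (hs.image N).bddAbove
  obtain ⟨d', hd⟩ := (hs.image d).bddAbove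
  refine ⟨N', d', fun Q hQs X ι p₁ p₂ => ?_⟩
  obtain ⟨Y, hY, hY'⟩ := h Q hQs X ι p₁ p₂
  exact ⟨Y, hY.mono subset_rfl (hN (Set.mem_image_of_mem N hQs))
    (hd (Set.mem_image_of_mem d hQs)) subset_rfl, hY'⟩

end FermatCircuits

/-! ### The values of the wires of the encoding -/

section Values

variable {F : Type*} {m n : ℕ}

/-- The value accumulated at a node after its first `k + 1` children. -/
noncomputable def AlgCircuit.partialPoly {X : Type*} [CommSemiring F] (R : AlgCircuit F X)
    (g : Fin R.size) (k : ℕ) : MvPolynomial X F :=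
  match R.gate g with
  | .var x => MvPolynomial.X x
  | .const a => MvPolynomial.C a
  | .add l _ _ w => ((l.take (k + 1)).map fun u : Fin g =>
      MvPolynomial.C (w u) * R.nodePoly ⟨u.1, u.2.trans g.2⟩).sum
  | .mul l _ _ => ((l.take (k + 1)).map fun u : Fin g => R.nodePoly ⟨u.1, u.2.trans g.2⟩).prod

/-- The children are distinct and precede `g`, so there are fewer than `R.size` of them. Hence only
finitely many partial values occur although `k` is unbounded. -/
theorem AlgCircuit.partialPoly_of_le {X : Type*} [CommSemiring F] (R : AlgCircuit F X)
    (g : Fin R.size) {k : ℕ} (hk : R.size ≤ k) : R.partialPoly g k = R.nodePoly g := by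
  have key (l : List (Fin g)) (hl : l.Nodup) : l.take (k + 1) = l := by
    apply List.take_of_length_le
    have := hl.length_le_card
    rw [Fintype.card_fin] at this
    omega
  rw [AlgCircuit.partialPoly, AlgCircuit.nodePoly]
  rcases R.gate g with x | a | ⟨l, hl, hnd, w⟩ | ⟨l, hl, hnd⟩
  · rfl
  · rfl
  · simp only [key l hnd]
  · simp only [key l hnd]

theorem AlgCircuit.partialPoly_min {X : Type*} [CommSemiring F] (R : AlgCircuit F X)
    (g : Fin R.size) {k N : ℕ} (hN : R.size ≤ N) :
    R.partialPoly g (min k N) = R.partialPoly g k := by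
  rcases le_total k N with h | h
  · rw [min_eq_left h]
  · rw [min_eq_right h, R.partialPoly_of_le g hN, R.partialPoly_of_le g (hN.trans h)]

open Classical in
/-- The polynomial in the input variables that is held by a wire of the encoding. -/
noncomputable def wireValue [CommRing F] (C : Fin m → AlgCircuit F (Fin n)) :
    Wire m n → MvPolynomial (Fin n) F
  | .input i => if ∃ j g, (C j).gate g = .var i then X i else 0
  | .gate j g => if h : g < (C j).size then (C j).nodePoly ⟨g, h⟩ else 0
  | .ext j g k => if h : g < (C j).size then (C j).partialPoly ⟨g, h⟩ k else 0

/-- The polynomial that is held by a signal of the encoding. -/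
noncomputable def signalValue [CommRing F] (C : Fin m → AlgCircuit F (Fin n)) :
    Signal F m n → MvPolynomial (Fin n) F
  | .scalar a => MvPolynomial.C a
  | .wire w => wireValue C w

/-- An enumeration of the values that occur in the encoding. -/
noncomputable def occurringValue [CommRing F] (C : Fin m → AlgCircuit F (Fin n)) :
    F ⊕ ((j : Fin m) × Fin (C j).size) × Fin ((∑ j, (C j).size) + 1) → MvPolynomial (Fin n) F
  | .inl a => MvPolynomial.C a
  | .inr v => (C v.1.1).partialPoly v.1.2 v.2

theorem AlgCircuit.size_le_sum (C : Fin m → AlgCircuit F (Fin n)) (j : Fin m) :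
    (C j).size ≤ ∑ j, (C j).size :=
  Finset.single_le_sum (f := fun j => (C j).size) (fun _ _ => Nat.zero_le _) (Finset.mem_univ j)

theorem partialPoly_mem_range [CommRing F] (C : Fin m → AlgCircuit F (Fin n)) (j : Fin m)
    (g : Fin (C j).size) (k : ℕ) : (C j).partialPoly g k ∈ Set.range (occurringValue C) := by
  refine ⟨.inr (⟨j, g⟩, ⟨min k (∑ j, (C j).size), by omega⟩), ?_⟩
  exact (C j).partialPoly_min g (AlgCircuit.size_le_sum C j)

theorem nodePoly_mem_range [CommRing F] (C : Fin m → AlgCircuit F (Fin n)) (j : Fin m)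
    (g : Fin (C j).size) : (C j).nodePoly g ∈ Set.range (occurringValue C) := by
  rw [← (C j).partialPoly_of_le g le_rfl]
  exact partialPoly_mem_range C j g _

theorem wireValue_mem_range [CommRing F] (C : Fin m → AlgCircuit F (Fin n)) (w : Wire m n) :
    wireValue C w ∈ Set.range (occurringValue C) := by
  -- Zero is held by wires that belong to no node, such as inputs that label none. Their bits occur
  -- only in Boolean axioms, and the default keeps the number of values bounded in terms of `|C|`
  -- instead of `n`.
  have h0 : (0 : MvPolynomial (Fin n) F) ∈ Set.range (occurringValue C) :=
    ⟨.inl 0, by simp [occurringValue]⟩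
  cases w with
  | input i =>
    rw [wireValue]
    split_ifs with h
    · obtain ⟨j, g, h⟩ := h
      have := nodePoly_mem_range C j g
      rwa [AlgCircuit.nodePoly, h] at this
    · exact h0
  | gate j g =>
    rw [wireValue]
    split_ifs with h
    exacts [nodePoly_mem_range C j _, h0]
  | ext j g k =>
    rw [wireValue]
    split_ifs with h
    exacts [partialPoly_mem_range C j _ k, h0]

theorem signalValue_mem_range [CommRing F] (C : Fin m → AlgCircuit F (Fin n))
    (s : Signal F m n) : signalValue C s ∈ Set.range (occurringValue C) := by
  cases s with
  | scalar a => exact ⟨.inl a, rfl⟩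
  | wire w => exact wireValue_mem_range C w

theorem signalValue_nodeSignal [CommRing F] (C : Fin m → AlgCircuit F (Fin n)) (j : Fin m)
    (g : Fin (C j).size) : signalValue C (nodeSignal j (C j) g) = (C j).nodePoly g := by
  rw [nodeSignal]
  rcases h : (C j).gate g with x | a | ⟨l, hl, hnd, w⟩ | ⟨l, hl, hnd⟩
  · simp only [signalValue, wireValue]
    rw [if_pos ⟨j, g, h⟩, AlgCircuit.nodePoly, h]
  · simp only [signalValue]
    rw [AlgCircuit.nodePoly, h]
  · simp [signalValue, wireValue]
  · simp [signalValue, wireValue]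

/-- The values of the wires satisfy the equation, by a bilinear identity of polynomials. -/
def TableEquation.Holds [CommRing F] (C : Fin m → AlgCircuit F (Fin n))
    (e : TableEquation F m n) : Prop :=
  ∃ α β γ : F, (∀ a b, e.table a b = α * a + β * b + γ * (a * b)) ∧
    signalValue C e.z = MvPolynomial.C α * signalValue C e.x +
      MvPolynomial.C β * signalValue C e.y +
      MvPolynomial.C γ * (signalValue C e.x * signalValue C e.y)

/-! ### Equations for gates of unbounded fan-in -/

section Fold

variable [CommRing F] {N : Type*} {C : Fin m → AlgCircuit F (Fin n)} {sig : N → Signal F m n}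
  {v : ℕ → Signal F m n} {g : Signal F m n} {step : N → F → F → F}
  {acc : List N → MvPolynomial (Fin n) F}

/-- Here `acc` is the sum or product over a list of children and `pre` the children already
absorbed; `v i` holds the result for the first `i + 1`, whence the condition on the length. -/
theorem chainEquations_holds {l : List N}
    (hv : ∀ k, signalValue C (v k) = acc (l.take (k + 1))) (hg : signalValue C g = acc l)
    (hstep : ∀ u pre s t, signalValue C s = acc pre → signalValue C t = acc (pre ++ [u]) →
      TableEquation.Holds C ⟨step u, sig u, s, t⟩) :
    ∀ (us pre : List N) (i : ℕ), pre.length = i + 1 → pre ++ us = l →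
      ∀ e ∈ chainEquations step sig v g i us, e.Holds C
  | [], _, _, _, _, e, he => by simp [chainEquations] at he
  | [u], pre, i, hi, hl, e, he => by
    simp only [chainEquations, List.mem_singleton] at he
    subst he hl
    exact hstep u pre _ _ (by rw [hv, ← hi, List.take_left]) hg
  | u :: u' :: us, pre, i, hi, hl, e, he => by
    rw [chainEquations, List.mem_cons] at he
    have hl' : (pre ++ [u]) ++ (u' :: us) = l := by simpa using hl
    rcases he with rfl | he
    · refine hstep u pre _ _ ?_ ?_
      · rw [hv, ← hl, ← hi, List.take_left]
      · rw [hv, ← hl', List.take_left' (by simp [hi])]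
    · exact chainEquations_holds hv hg hstep (u' :: us) (pre ++ [u]) (i + 1) (by simp [hi]) hl' e he

theorem foldEquations_holds {only : N → F → F → F} {first : N → N → F → F → F} {l : List N}
    (hv : ∀ k, signalValue C (v k) = acc (l.take (k + 1))) (hg : signalValue C g = acc l)
    (honly : ∀ u t, signalValue C t = acc [u] →
      TableEquation.Holds C ⟨only u, sig u, sig u, t⟩)
    (hfirst : ∀ u₁ u₂ t, signalValue C t = acc [u₁, u₂] →
      TableEquation.Holds C ⟨first u₁ u₂, sig u₁, sig u₂, t⟩)
    (hstep : ∀ u pre s t, signalValue C s = acc pre → signalValue C t = acc (pre ++ [u]) →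
      TableEquation.Holds C ⟨step u, sig u, s, t⟩) :
    ∀ e ∈ foldEquations only first step sig v g l, e.Holds C := by
  intro e he
  match l with
  | [] => simp [foldEquations] at he
  | [u] =>
    simp only [foldEquations, List.mem_singleton] at he
    exact he ▸ honly u g hg
  | [u₁, u₂] =>
    simp only [foldEquations, List.mem_singleton] at he
    exact he ▸ hfirst u₁ u₂ g hg
  | u₁ :: u₂ :: u₃ :: us =>
    rw [foldEquations, List.mem_cons] at he
    rcases he with rfl | he
    · exact hfirst u₁ u₂ _ (by rw [hv]; rfl)
    · exact chainEquations_holds hv hg hstep (u₃ :: us) [u₁, u₂] 1 rfl rfl e he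

end Fold

theorem nodeEquations_holds [CommRing F] (C : Fin m → AlgCircuit F (Fin n)) (j : Fin m)
    (g : Fin (C j).size) : ∀ e ∈ nodeEquations j (C j) g, e.Holds C := by
  intro e he
  rw [nodeEquations] at he
  rcases h : (C j).gate g with x | a | ⟨l, hl, hnd, w⟩ | ⟨l, hl, hnd⟩ <;>
    simp only [h] at he
  · simp at he
  · simp at he
  · refine foldEquations_holds (acc := fun l => (l.map fun u : Fin g =>
      MvPolynomial.C (w u) * (C j).nodePoly ⟨u.1, u.2.trans g.2⟩).sum) ?_ ?_ ?_ ?_ ?_ e he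
    · intro k
      simp only [signalValue, wireValue, Fin.is_lt, dite_true, AlgCircuit.partialPoly, h]
    · simp only [signalValue, wireValue, Fin.is_lt, dite_true]
      rw [AlgCircuit.nodePoly, h]
    · intro u t ht
      exact ⟨w u, 0, 0, by simp, by simp [ht, signalValue_nodeSignal]⟩
    · intro u₁ u₂ t ht
      exact ⟨w u₁, w u₂, 0, by simp, by simp [ht, signalValue_nodeSignal]⟩
    · intro u pre s t hs ht
      refine ⟨w u, 1, 0, by simp, ?_⟩
      simp [ht, hs, signalValue_nodeSignal, add_comm]
  · refine foldEquations_holds (acc := fun l => (l.map fun u : Fin g =>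
      (C j).nodePoly ⟨u.1, u.2.trans g.2⟩).prod) ?_ ?_ ?_ ?_ ?_ e he
    · intro k
      simp only [signalValue, wireValue, Fin.is_lt, dite_true, AlgCircuit.partialPoly, h]
    · simp only [signalValue, wireValue, Fin.is_lt, dite_true]
      rw [AlgCircuit.nodePoly, h]
    · intro u t ht
      exact ⟨1, 0, 0, by simp, by simp [ht, signalValue_nodeSignal]⟩
    · intro u₁ u₂ t ht
      exact ⟨0, 0, 1, by simp, by simp [ht, signalValue_nodeSignal]⟩
    · intro u pre s t hs ht
      refine ⟨0, 0, 1, by simp, ?_⟩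
      simp [ht, hs, signalValue_nodeSignal, mul_comm]

end Values

/-! ### The axioms of the encoding under the substitution -/

section Axioms

variable {F : Type*} [Field F] [Fintype F] {m n : ℕ}

/-- The substitution of the indicator polynomials of the values for the unary bits. -/
noncomputable def bitValue (C : Fin m → AlgCircuit F (Fin n)) (b : Wire m n × F) :
    MvPolynomial (Fin n) F :=
  pointIndicator b.2 (wireValue C b.1)

theorem aeval_bitValue_bit (C : Fin m → AlgCircuit F (Fin n)) (s : Signal F m n) (c : F) :
    aeval (bitValue C) (s.bit c) = pointIndicator c (signalValue C s) := by
  cases s with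
  | scalar a =>
    have := map_pointIndicator (Algebra.ofId F (MvPolynomial (Fin n) F)) c a
    rw [pointIndicator_eq_ite] at this
    simp only [Signal.bit, signalValue]
    rw [← algebraMap_eq, ← Algebra.ofId_apply, ← this]
    split_ifs <;> simp
  | wire w => simp [Signal.bit, signalValue, bitValue]

omit [Fintype F] in
theorem BoolClause.aeval_toPoly {V Y Y' : Type*} (κ : BoolClause V) (s : V → MvPolynomial Y F)
    (t : Y → MvPolynomial Y' F) : aeval t (κ.toPoly s) = κ.toPoly fun v => aeval t (s v) := by
  simp only [BoolClause.toPoly, map_mul, map_prod, map_sub, map_one]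

/-- The values of the three places of a bilinear equation. -/
noncomputable def placeValue (α β γ : F) : Place → MvPolynomial (Fin 2) F
  | .x => X 0
  | .y => X 1
  | .z => C α * X 0 + C β * X 1 + C γ * (X 0 * X 1)

/-- A clause about the unary bits of a bilinear equation, as a polynomial in its arguments. -/
noncomputable def tableClausePoly (α β γ : F) (κ : BoolClause (Place × F)) :
    MvPolynomial (Fin 2) F :=
  κ.toPoly fun b => pointIndicator b.2 (placeValue α β γ b.1)

/-- A clause about the unary bits of a single value, as a polynomial in this value. -/
noncomputable def valueClausePoly (P N : Finset F) : MvPolynomial (Fin 2) F :=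
  (∏ c ∈ P, (1 - pointIndicator c (X 0))) * ∏ c ∈ N, pointIndicator c (X 0)

variable (F) in
/-- The polynomials in at most two values that arise from the axioms of the encoding and that
vanish at all points. -/
def localAxioms : Set (MvPolynomial (Fin 2) F) :=
  {Q | (∀ a b : F, eval ![a, b] Q = 0) ∧
    ((∃ α β γ κ, Q = tableClausePoly α β γ κ) ∨ (∃ P N, Q = valueClausePoly P N) ∨
      ∃ c : F, Q = pointIndicator c (X 0) ^ 2 - pointIndicator c (X 0))}

omit [Field F] in
theorem finite_boolClause : Finite (BoolClause (Place × F)) := by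
  have h1 : Finite Place := Finite.of_surjective (![Place.x, Place.y, Place.z]) (by
    rintro (_ | _ | _)
    exacts [⟨0, rfl⟩, ⟨1, rfl⟩, ⟨2, rfl⟩])
  refine Finite.of_injective (fun κ : BoolClause (Place × F) => (κ.pos, κ.neg)) ?_
  rintro ⟨_, _⟩ ⟨_, _⟩ h
  simpa using h

/-- The coefficients and the clauses over the bits of three places range over finite sets. The
choice of a CNF for each table does not enter, so later bounds are independent of it. -/
theorem finite_localAxioms : (localAxioms F).Finite := by
  have := finite_boolClause (F := F)
  refine ((Set.finite_range fun v : F × F × F × BoolClause (Place × F) =>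
    tableClausePoly v.1 v.2.1 v.2.2.1 v.2.2.2).union
    ((Set.finite_range fun v : Finset F × Finset F => valueClausePoly v.1 v.2).union
    (Set.finite_range fun c : F =>
      (pointIndicator c (X 0) ^ 2 - pointIndicator c (X 0) : MvPolynomial (Fin 2) F)))).subset ?_
  rintro Q ⟨-, ⟨α, β, γ, κ, rfl⟩ | ⟨P, N, rfl⟩ | ⟨c, rfl⟩⟩
  · exact Or.inl ⟨(α, β, γ, κ), rfl⟩
  · exact Or.inr (Or.inl ⟨(P, N), rfl⟩)
  · exact Or.inr (Or.inr ⟨c, rfl⟩)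

theorem eval_pointIndicator {σ : Type*} (x : σ → F) (c : F) (p : MvPolynomial σ F) :
    eval x (pointIndicator c p) = pointIndicator c (eval x p) := by
  have := map_pointIndicator (aeval (R := F) x) c p
  simpa [aeval_eq_eval] using this

/-- At a point `(a, b)`, call a bit true if its index is the value of its place. This assignment
satisfies every clause of the table, and a true literal gives a vanishing factor. -/
theorem tableClausePoly_mem_localAxioms {φ : TableCNF F} {h : F → F → F} {α β γ : F}
    (hh : ∀ a b, h a b = α * a + β * b + γ * (a * b)) {κ : BoolClause (Place × F)}
    (hκ : κ ∈ φ.clauses h) : tableClausePoly α β γ κ ∈ localAxioms F := by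
  refine ⟨fun a b => ?_, Or.inl ⟨α, β, γ, κ, rfl⟩⟩
  have hval (p : Place) : eval ![a, b] (placeValue α β γ p) =
      match p with | .x => a | .y => b | .z => h a b := by
    cases p <;> simp [placeValue, hh]
  have hsat := (φ.sat_iff h (fun v => v.2 = eval ![a, b] (placeValue α β γ v.1))).2
    ⟨a, b, by simp [hval], by simp [hval], by simp [hval]⟩ κ hκ
  rw [tableClausePoly, BoolClause.toPoly, map_mul, map_prod, map_prod]
  rcases hsat with ⟨v, hv, hτ⟩ | ⟨v, hv, hτ⟩
  · rw [Finset.prod_eq_zero hv, zero_mul]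
    rw [map_sub, map_one, eval_pointIndicator, ← hτ, pointIndicator_self, sub_self]
  · rw [Finset.prod_eq_zero hv, mul_zero]
    rw [eval_pointIndicator, pointIndicator_of_ne (Ne.symm hτ)]

theorem valueClausePoly_univ_mem : valueClausePoly (Finset.univ : Finset F) ∅ ∈ localAxioms F := by
  refine ⟨fun a b => ?_, Or.inr (Or.inl ⟨_, _, rfl⟩)⟩
  rw [valueClausePoly, map_mul, map_prod, Finset.prod_eq_zero (Finset.mem_univ a), zero_mul]
  simp [eval_pointIndicator, pointIndicator_self]

open Classical in
theorem valueClausePoly_pair_mem {c c' : F} (h : c ≠ c') :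
    valueClausePoly ∅ {c, c'} ∈ localAxioms F := by
  refine ⟨fun a b => ?_, Or.inr (Or.inl ⟨_, _, rfl⟩)⟩
  rw [valueClausePoly, map_mul, Finset.prod_pair h]
  simp only [map_mul, eval_pointIndicator, eval_X, Matrix.cons_val_zero]
  by_cases hc : a = c
  · rw [pointIndicator_of_ne (c := c') (by rintro rfl; exact h hc.symm)]; simp
  · rw [pointIndicator_of_ne hc]; simp

theorem booleanAxiom_mem (c : F) :
    (pointIndicator c (X 0) ^ 2 - pointIndicator c (X 0) : MvPolynomial (Fin 2) F) ∈
      localAxioms F := by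
  refine ⟨fun a b => ?_, Or.inr (Or.inr ⟨c, rfl⟩)⟩
  simp only [map_sub, map_pow, eval_pointIndicator, eval_X, Matrix.cons_val_zero,
    pointIndicator_eq_ite]
  split_ifs <;> simp

theorem aeval_boolean_eq (C : Fin m → AlgCircuit F (Fin n)) (b : Wire m n × F) :
    bitValue C b ^ 2 - bitValue C b = aeval ![wireValue C b.1, wireValue C b.1]
      (pointIndicator b.2 (X 0) ^ 2 - pointIndicator b.2 (X 0) : MvPolynomial (Fin 2) F) := by
  simp [map_pointIndicator, bitValue, -aeval_eq_bind₁]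

theorem aeval_valueClause_eq (C : Fin m → AlgCircuit F (Fin n)) (i : Fin n) {P N : Finset F}
    {κ : BoolClause (Wire m n × F)} (hP : ∀ b, b ∈ κ.pos ↔ ∃ c ∈ P, (.input i, c) = b)
    (hN : ∀ b, b ∈ κ.neg ↔ ∃ c ∈ N, (.input i, c) = b) :
    aeval (bitValue C) (κ.toPoly (X : Wire m n × F → MvPolynomial (Wire m n × F) F)) =
      aeval ![wireValue C (.input i), wireValue C (.input i)] (valueClausePoly P N) := by
  classical
  have hinj : Function.Injective fun c : F => ((.input i : Wire m n), c) :=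
    fun c c' h => (Prod.ext_iff.1 h).2
  have hP' : κ.pos = P.image fun c => (.input i, c) := by ext b; rw [hP, Finset.mem_image]
  have hN' : κ.neg = N.image fun c => (.input i, c) := by ext b; rw [hN, Finset.mem_image]
  rw [BoolClause.aeval_toPoly, BoolClause.toPoly, valueClausePoly, hP', hN',
    Finset.prod_image hinj.injOn, Finset.prod_image hinj.injOn]
  simp [map_pointIndicator, bitValue, -aeval_eq_bind₁]

theorem aeval_tableClause_eq {C : Fin m → AlgCircuit F (Fin n)} {e : TableEquation F m n}
    {α β γ : F} (hz : signalValue C e.z = MvPolynomial.C α * signalValue C e.x +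
      MvPolynomial.C β * signalValue C e.y +
      MvPolynomial.C γ * (signalValue C e.x * signalValue C e.y)) (κ : BoolClause (Place × F)) :
    aeval (bitValue C) (κ.toPoly e.bits) =
      aeval ![signalValue C e.x, signalValue C e.y] (tableClausePoly α β γ κ) := by
  rw [tableClausePoly, BoolClause.aeval_toPoly, BoolClause.aeval_toPoly]
  congr 1
  funext ⟨p, c⟩
  rw [map_pointIndicator]
  cases p <;> simp only [TableEquation.bits, aeval_bitValue_bit, placeValue]
  · simp
  · simp
  · simp [hz]

/-- Under the substitution, each axiom of the encoding becomes a local axiom at two of the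
occurring values, or an axiom about the output of a circuit. -/
theorem aeval_mem_cnfEncoding {φ : TableCNF F} {C : Fin m → AlgCircuit F (Fin n)}
    {f : MvPolynomial (Wire m n × F) F} (hf : f ∈ cnfEncoding φ C) :
    (∃ Q ∈ localAxioms F, ∃ p₁ ∈ Set.range (occurringValue C),
      ∃ p₂ ∈ Set.range (occurringValue C), aeval (bitValue C) f = aeval ![p₁, p₂] Q) ∨
    (∃ j, aeval (bitValue C) f = pointIndicator (0 : F) (C j).poly - 1) ∨
    ∃ j, ∃ a : F, a ≠ 0 ∧ aeval (bitValue C) f = pointIndicator a (C j).poly := by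
  classical
  rcases hf with (((⟨j, g, i, -, κ, hκ, rfl⟩ | ⟨j, g, e, he, κ, hκ, rfl⟩) | ⟨b, rfl⟩) |
    ⟨j, rfl⟩) | ⟨j, a, ha, rfl⟩
  · left
    rcases hκ with ⟨hneg, hpos⟩ | ⟨hpos, a, c, hac, hneg⟩
    · refine ⟨_, valueClausePoly_univ_mem, _, wireValue_mem_range C (.input i), _,
        wireValue_mem_range C (.input i), aeval_valueClause_eq C i ?_ ?_⟩
      · rintro ⟨w, c⟩; simp [hpos, eq_comm]
      · simp [hneg]
    · refine ⟨_, valueClausePoly_pair_mem hac, _, wireValue_mem_range C (.input i), _,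
        wireValue_mem_range C (.input i), aeval_valueClause_eq C i ?_ ?_⟩
      · simp [hpos]
      · intro b; simp [hneg, eq_comm]
  · obtain ⟨α, β, γ, hh, hz⟩ := nodeEquations_holds C j g e he
    exact Or.inl ⟨_, tableClausePoly_mem_localAxioms hh hκ, _, signalValue_mem_range C e.x, _,
      signalValue_mem_range C e.y, aeval_tableClause_eq hz κ⟩
  · refine Or.inl ⟨_, booleanAxiom_mem b.2, _, wireValue_mem_range C b.1, _,
      wireValue_mem_range C b.1, ?_⟩
    rw [← aeval_boolean_eq, map_sub, map_pow, aeval_X]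
  · refine Or.inr (Or.inl ⟨j, ?_⟩)
    rw [map_sub, map_one, aeval_bitValue_bit, signalValue_nodeSignal]
    rfl
  · refine Or.inr (Or.inr ⟨j, a, ha, ?_⟩)
    rw [aeval_bitValue_bit, signalValue_nodeSignal]
    rfl

end Axioms

/-! ### Circuits for the substitution -/

section Substitution

variable {F : Type*} [Field F] [Fintype F]

variable (F) in
theorem exists_computes_pointIndicator :
    ∃ N d, ∀ (Y : Type) (c : F) (p : MvPolynomial Y F),
      Computes {p} N d {pointIndicator c p, pointIndicator c p - 1} := by
  choose N d h using fun c : F =>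
    exists_computes_aeval (pointIndicator c (X 0) : MvPolynomial (Fin 1) F)
  choose N' d' h' using fun c : F =>
    exists_computes_aeval (pointIndicator c (X 0) - 1 : MvPolynomial (Fin 1) F)
  refine ⟨∑ c, (N c + N' c), ∑ c, (d c + d' c), fun Y c p => ?_⟩
  have hN := Finset.single_le_sum (f := fun c => N c + N' c) (fun _ _ => Nat.zero_le _)
    (Finset.mem_univ c)
  have hd := Finset.single_le_sum (f := fun c => d c + d' c) (fun _ _ => Nat.zero_le _)
    (Finset.mem_univ c)
  have h1 := (h c Y fun _ => p).mono subset_rfl le_rfl (Nat.le_add_right _ (d' c)) subset_rfl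
  have h2 := (h' c Y fun _ => p).mono subset_rfl le_rfl (Nat.le_add_left _ (d c)) subset_rfl
  refine (h1.union h2).mono (by simp) hN hd ?_
  simp [map_pointIndicator, Set.insert_subset_iff, -aeval_eq_bind₁]

/-- The variables that label nodes of a circuit. -/
def AlgCircuit.leaves {X : Type*} (R : AlgCircuit F X) : Set (MvPolynomial X F) :=
  {p | ∃ (g : Fin R.size) (x : X), R.gate g = .var x ∧ p = MvPolynomial.X x}

omit [Fintype F] in
-- One further gate over the nodes of the circuit, attached by `Computes.comp`, whence the depth `+
-- 2`.
theorem AlgCircuit.computes_partialPoly {X : Type*} (R : AlgCircuit F X) (g : Fin R.size) (k : ℕ) :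
    Computes R.leaves (2 * R.size + 1) (R.depth + 2) {R.partialPoly g k} := by
  have key (l : List (Fin g)) (hl : l.Nodup) : (l.take (k + 1)).length ≤ R.size := by
    have := hl.length_le_card
    rw [Fintype.card_fin] at this
    have := List.length_take_le' (k + 1) l
    omega
  rw [AlgCircuit.partialPoly]
  rcases h : R.gate g with x | a | ⟨l, hl, hnd, w⟩ | ⟨l, hl, hnd⟩
  · exact (Computes.of_mem (show MvPolynomial.X x ∈ R.leaves from ⟨g, x, h, rfl⟩)).mono subset_rfl (by omega) (by omega) subset_rfl
  · exact (Computes.const _ a).mono subset_rfl (by omega) (by omega) subset_rfl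
  · have := key l hnd
    exact (R.computes.comp (.list_sum _ w _ fun u _ => Set.mem_range_self _)).mono subset_rfl
      (by omega) (by omega) Set.subset_union_right
  · have := key l hnd
    exact (R.computes.comp (.list_prod _ _ fun u _ => Set.mem_range_self _)).mono subset_rfl
      (by omega) (by omega) Set.subset_union_right

variable (F) in
theorem exists_computes_ipsTwist_leaves :
    ∃ N d, ∀ (X ι : Type) (R : AlgCircuit F X),
      Computes (Set.range (MvPolynomial.X : IPSVar X ι → MvPolynomial _ F)) (R.size * N) d
        (ipsTwist F X ι '' R.leaves) := by
  obtain ⟨N, d, h⟩ := exists_computes_aeval (MvPolynomial.X 0 ^ Fintype.card F -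
    MvPolynomial.X 1 * ∑ k ∈ Finset.range (Fintype.card F - 1), MvPolynomial.X 0 ^ k :
      MvPolynomial (Fin 2) F)
  refine ⟨N, d, fun X ι R => ?_⟩
  have h' (g : Fin R.size) : Computes (Set.range (MvPolynomial.X : IPSVar X ι → MvPolynomial _ F)) N d
      (ipsTwist F X ι '' {p | ∃ x : X, R.gate g = .var x ∧ p = MvPolynomial.X x}) := by
    by_cases hg : ∃ x, R.gate g = .var x
    · obtain ⟨x, hx⟩ := hg
      refine (h _ ![MvPolynomial.X (.x x), MvPolynomial.X (.z x)]).mono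
        (by simp [Set.insert_subset_iff]) le_rfl le_rfl ?_
      rintro _ ⟨_, ⟨y, hy, rfl⟩, rfl⟩
      rw [hx, AlgGate.var.injEq] at hy
      subst hy
      simp [ipsTwist, -aeval_eq_bind₁]
    · refine (Computes.empty _ d).mono subset_rfl (Nat.zero_le _) le_rfl ?_
      rintro _ ⟨_, ⟨y, hy, rfl⟩, rfl⟩
      exact hg ⟨y, hy⟩
  refine (Computes.iUnion h').mono subset_rfl (by simp) le_rfl ?_
  rintro _ ⟨_, ⟨g, x, hg, rfl⟩, rfl⟩
  exact Set.mem_iUnion.2 ⟨g, _, ⟨x, hg, rfl⟩, rfl⟩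

variable (F) in
-- Two copies of the circuit suffice, one on the variables and one on their twists, because the
-- twist is an algebra map. Only the leaves and the top are deepened. The bound `2 ≤ N` leaves room
-- for the two constants needed at a scalar value.
theorem exists_computes_ipsFermat_partialPoly :
    ∃ N d, 2 ≤ N ∧ ∀ (X ι : Type) (R : AlgCircuit F X) (g : Fin R.size) (k : ℕ),
      Computes (Set.range (MvPolynomial.X : IPSVar X ι → MvPolynomial _ F)) (N * (R.size + 1)) (R.depth + d)
        {ipsEmbed F X ι (R.partialPoly g k), ipsFermat (R.partialPoly g k)} := by
  obtain ⟨N, d, h⟩ := exists_computes_ipsTwist_leaves F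
  obtain ⟨N', d', h'⟩ := exists_computes_aeval
    (MvPolynomial.X 0 ^ Fintype.card F - MvPolynomial.X 1 : MvPolynomial (Fin 2) F)
  refine ⟨N + N' + 4, d + 4 + d', by omega, fun X ι R g k => ?_⟩
  have hp := R.computes_partialPoly g k
  have h1 := (hp.map (ipsEmbed F X ι)).mono (B' := Set.range (MvPolynomial.X : IPSVar X ι → MvPolynomial _ F))
    (by
      rintro _ ⟨_, ⟨g, x, -, rfl⟩, rfl⟩
      exact ⟨.x x, by simp [ipsEmbed]⟩) le_rfl
    (show R.depth + 2 ≤ d + 1 + (R.depth + 2) by omega) subset_rfl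
  have h2 := (h X ι R).comp (hp.map (ipsTwist F X ι))
  have h3 := (h1.union h2).comp ((h' _ ![ipsEmbed F X ι (R.partialPoly g k),
    ipsTwist F X ι (R.partialPoly g k)]).mono (by simp [Set.insert_subset_iff])
      le_rfl le_rfl subset_rfl)
  refine h3.mono subset_rfl ?_ (by omega) ?_
  · nlinarith
  · simp [Set.insert_subset_iff, ipsFermat, -aeval_eq_bind₁]

/-- The polynomials from which the bits of given values, and derivations of their properties, are
computed. -/
def fermatBase {X V : Type*} (ι : Type*) (val : V → MvPolynomial X F) :
    Set (MvPolynomial (IPSVar X ι) F) :=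
  ⋃ v, {ipsEmbed F X ι (val v), ipsFermat (val v)}

theorem ipsEmbed_mem_fermatBase {X V ι : Type*} (val : V → MvPolynomial X F) (v : V) :
    ipsEmbed F X ι (val v) ∈ fermatBase ι val :=
  Set.mem_iUnion.2 ⟨v, Or.inl rfl⟩

theorem ipsFermat_mem_fermatBase {X V ι : Type*} (val : V → MvPolynomial X F) (v : V) :
    ipsFermat (val v) ∈ fermatBase ι val :=
  Set.mem_iUnion.2 ⟨v, Or.inr rfl⟩

variable (F) in
theorem exists_computes_ipsFermat_occurringValue :
    ∃ N d, ∀ (m n : ℕ) (C : Fin m → AlgCircuit F (Fin n)) (Δ : ℕ), (∀ j, (C j).depth ≤ Δ) →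
      Computes (Set.range (MvPolynomial.X : IPSVar (Fin n) (Fin m) → MvPolynomial _ F))
        ((Fintype.card F + (∑ j, (C j).size) * (∑ j, (C j).size + 1)) *
          (N * (∑ j, (C j).size + 1))) (Δ + d)
        (fermatBase (Fin m) (occurringValue C)) := by
  obtain ⟨N, d, hN, h⟩ := exists_computes_ipsFermat_partialPoly F
  refine ⟨N, d, fun m n C Δ hΔ => ?_⟩
  refine (Computes.iUnion (n := N * (∑ j, (C j).size + 1)) (d := Δ + d) ?_).mono subset_rfl
    (by simp) le_rfl subset_rfl
  rintro (a | ⟨⟨j, g⟩, k⟩)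
  -- For a scalar the Fermat derivation is `a^q - a = 0`.
  · refine ((Computes.const _ a).union (.const _ 0)).mono subset_rfl
      (hN.trans (Nat.le_mul_of_pos_right _ (Nat.succ_pos _)))
      (Nat.zero_le _) ?_
    simp [Set.insert_subset_iff, occurringValue, ipsFermat, ipsEmbed, ipsTwist, ← map_pow,
      FiniteField.pow_card]
  · refine (h _ _ (C j) g k).mono subset_rfl ?_ (Nat.add_le_add_right (hΔ j) d) subset_rfl
    exact Nat.mul_le_mul_left _ (Nat.add_le_add_right (AlgCircuit.size_le_sum C j) 1)

theorem pointIndicator_zero_of_ne {A : Type*} [CommRing A] [Algebra F A] {c : F} (hc : c ≠ 0) :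
    pointIndicator c (0 : A) = 0 := by
  have := map_pointIndicator (Algebra.ofId F A) c 0
  rwa [pointIndicator_of_ne hc.symm, map_zero, eq_comm] at this

theorem pointIndicator_zero_zero {A : Type*} [CommRing A] [Algebra F A] :
    pointIndicator (0 : F) (0 : A) = 1 := by
  have := map_pointIndicator (Algebra.ofId F A) (0 : F) 0
  rwa [pointIndicator_self, map_zero, map_one, eq_comm] at this

variable (F) in
theorem exists_computes_bits :
    ∃ N d, ∀ (X ι : Type) (V : Type _) [Fintype V] (val : V → MvPolynomial X F),
      Computes (fermatBase ι val) (Fintype.card V * N) d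
        {p | ∃ v, ∃ c : F, p = pointIndicator c (ipsEmbed F X ι (val v))} := by
  obtain ⟨N, d, h⟩ := exists_computes_pointIndicator F
  refine ⟨Fintype.card F * N, d, fun X ι V _ val => ?_⟩
  have h1 := Computes.iUnion fun k : V × F =>
    (h _ k.2 (ipsEmbed F X ι (val k.1))).mono (B' := fermatBase ι val)
      (Set.singleton_subset_iff.2 (ipsEmbed_mem_fermatBase val k.1)) le_rfl le_rfl subset_rfl
  refine h1.mono subset_rfl (by rw [Fintype.card_prod, mul_assoc]) le_rfl ?_
  rintro _ ⟨v, c, rfl⟩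
  exact Set.mem_iUnion.2 ⟨(v, c), Or.inl rfl⟩

variable (F) in
theorem exists_computes_localAxioms :
    ∃ N d, ∀ (X ι : Type) (V : Type _) [Fintype V] (val : V → MvPolynomial X F),
      ∃ T : Set (MvPolynomial (IPSVar X ι) F),
      Computes (fermatBase ι val) (Fintype.card V * Fintype.card V * N) d T ∧
      ∀ Q ∈ localAxioms F, ∀ v₁ v₂, ∃ p ∈ T, aeval (ipsZeroSubst (F := F)) p = 0 ∧
        ∀ f, aeval (ipsAxiomSubst f) p = aeval ![val v₁, val v₂] Q := by
  obtain ⟨N, d, h⟩ := exists_computes_of_finite (finite_localAxioms (F := F)) fun Q hQ => hQ.1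
  obtain ⟨s, hs⟩ := (finite_localAxioms (F := F)).exists_finset_coe
  refine ⟨s.card * N, d, fun X ι V _ val => ?_⟩
  choose! Y hY hY0 hYf using fun Q hQ => h Q hQ X ι
  have h1 (k : V × V) : Computes (fermatBase ι val) (s.card * N) d
      (⋃ Q ∈ s, {Y Q (val k.1) (val k.2)}) := by
    refine Computes.biUnion s fun Q hQ => (hY Q (hs ▸ Finset.mem_coe.2 hQ) _ _).mono ?_ le_rfl
      le_rfl subset_rfl
    simp [Set.insert_subset_iff, ipsEmbed_mem_fermatBase, ipsFermat_mem_fermatBase]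
  have h2 := Computes.iUnion h1
  rw [Fintype.card_prod] at h2
  refine ⟨_, h2, fun Q hQ v₁ v₂ => ⟨Y Q (val v₁) (val v₂), ?_, hY0 Q hQ _ _, hYf Q hQ _ _⟩⟩
  exact Set.mem_iUnion.2 ⟨(v₁, v₂), Set.mem_biUnion (Finset.mem_coe.1 (hs ▸ hQ)) rfl⟩

variable (F) in
-- These serve as derivations of the output axioms: at `y j = 0` the indicator of `0` is `1` and all
-- others vanish.
theorem exists_computes_outputs :
    ∃ N d, ∀ (X : Type) (m : ℕ),
      Computes (Set.range (MvPolynomial.X : IPSVar X (Fin m) → MvPolynomial _ F)) (m * N) d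
        {p | ∃ (j : Fin m) (c : F),
          p = pointIndicator c (MvPolynomial.X (IPSVar.y j) : MvPolynomial (IPSVar X (Fin m)) F) ∨
          p = pointIndicator c (MvPolynomial.X (IPSVar.y j) : MvPolynomial (IPSVar X (Fin m)) F) -
            1} := by
  obtain ⟨N, d, h⟩ := exists_computes_pointIndicator F
  refine ⟨Fintype.card F * N, d, fun X m => ?_⟩
  have h0 (k : Fin m × F) := (h (IPSVar X (Fin m)) k.2 (MvPolynomial.X (IPSVar.y k.1))).mono
    (Set.singleton_subset_iff.2 (Set.mem_range_self (f := MvPolynomial.X) _))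
    le_rfl le_rfl subset_rfl
  have h1 := Computes.iUnion h0
  refine h1.mono subset_rfl (by rw [Fintype.card_prod, mul_assoc, Fintype.card_fin]) le_rfl ?_
  rintro _ ⟨j, c, hp⟩
  exact Set.mem_iUnion.2 ⟨(j, c), hp⟩

theorem aeval_zero_pointIndicator_y {X ι : Type*} (c : F) (j : ι) :
    aeval (ipsZeroSubst (F := F) (X := X))
      (pointIndicator c (MvPolynomial.X (IPSVar.y j) : MvPolynomial (IPSVar X ι) F)) =
        pointIndicator c 0 := by
  rw [map_pointIndicator, aeval_X, ipsZeroSubst]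

theorem aeval_axiom_pointIndicator_y {X ι : Type*} (f : ι → MvPolynomial X F) (c : F) (j : ι) :
    aeval (ipsAxiomSubst f)
      (pointIndicator c (MvPolynomial.X (IPSVar.y j) : MvPolynomial (IPSVar X ι) F)) =
        pointIndicator c (f j) := by
  rw [map_pointIndicator, aeval_X, ipsAxiomSubst]

variable (F) in
/-- Small and shallow circuits for the substituted bits and for IPS derivations of the substituted
axioms of the encoding. -/
theorem exists_computes_substitution :
    ∃ (c : ℕ) (P : Polynomial ℕ), ∀ (φ : TableCNF F) (m n : ℕ) (C : Fin m → AlgCircuit F (Fin n))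
      (Δ : ℕ), (∀ j, (C j).depth ≤ Δ) →
      ∃ T : Set (MvPolynomial (IPSVar (Fin n) (Fin m)) F),
        Computes (Set.range MvPolynomial.X) (P.eval (∑ j, (C j).size)) (Δ + c) T ∧
        (∀ b, ∃ p ∈ T, aeval (ipsZeroSubst (F := F)) p = bitValue C b ∧
          aeval (ipsAxiomSubst fun j => (C j).poly) p = bitValue C b) ∧
        (∀ f ∈ cnfEncoding φ C, ∃ p ∈ T, aeval (ipsZeroSubst (F := F)) p = 0 ∧
          aeval (ipsAxiomSubst fun j => (C j).poly) p = aeval (bitValue C) f) ∧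
        ∀ b, ∃ p ∈ T, aeval (ipsZeroSubst (F := F)) p = 0 ∧
          aeval (ipsAxiomSubst fun j => (C j).poly) p = bitValue C b ^ 2 - bitValue C b := by
  obtain ⟨N₁, d₁, h₁⟩ := exists_computes_ipsFermat_occurringValue F
  obtain ⟨N₂, d₂, h₂⟩ := exists_computes_bits F
  obtain ⟨N₃, d₃, h₃⟩ := exists_computes_localAxioms F
  obtain ⟨N₄, d₄, h₄⟩ := exists_computes_outputs F
  -- `V` counts the occurring values: `q` scalars, and for total size `s` at most `s(s + 1)` partial
  -- results. The bound adds the values with their Fermat derivations, the bits and local axioms,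
  -- and the outputs.
  let V : Polynomial ℕ := .C (Fintype.card F) + .X * (.X + 1)
  refine ⟨d₁ + 1 + (d₂ + d₃) + d₄, V * (.C N₁ * (.X + 1)) + (V * .C N₂ + V * V * .C N₃) +
    .X * .C N₄, fun φ m n C Δ hΔ => ?_⟩
  -- Each circuit has an output node and hence positive size.
  have hm : m ≤ ∑ j, (C j).size := by
    have := Finset.sum_le_sum (s := Finset.univ) fun (j : Fin m) _ =>
      (Nat.succ_le_of_lt (Fin.pos (C j).out))
    simpa using this
  obtain ⟨T, hT, hTQ⟩ := h₃ (Fin n) (Fin m) _ (occurringValue C)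
  have hlocal := ((h₂ (Fin n) (Fin m) _ (occurringValue C)).mono subset_rfl le_rfl
    (Nat.le_add_right d₂ d₃) subset_rfl).union
    (hT.mono subset_rfl le_rfl (Nat.le_add_left d₃ d₂) subset_rfl)
  have hall := (((h₁ m n C Δ hΔ).comp hlocal).mono subset_rfl le_rfl
    (show _ ≤ Δ + (d₁ + 1 + (d₂ + d₃) + d₄) by omega) subset_rfl).union
    ((h₄ (Fin n) m).mono subset_rfl le_rfl (by omega) subset_rfl)
  refine ⟨_, hall.mono subset_rfl ?_ le_rfl subset_rfl, ?_, ?_, ?_⟩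
  · simp only [V, Fintype.card_prod, Fintype.card_sum, Fintype.card_sigma, Fintype.card_fin,
      Polynomial.eval_add, Polynomial.eval_mul, Polynomial.eval_C, Polynomial.eval_X,
      Polynomial.eval_one]
    exact Nat.add_le_add_left (Nat.mul_le_mul_right _ hm) _
  · intro b
    obtain ⟨v, hv⟩ := wireValue_mem_range C b.1
    -- The image of a bit contains no placeholders, so both substitutions agree on it.
    refine ⟨pointIndicator b.2 (ipsEmbed F _ _ (occurringValue C v)),
      Or.inl (Or.inr (Or.inl ⟨v, b.2, rfl⟩)), ?_, ?_⟩
    · rw [map_pointIndicator, aeval_zero_ipsEmbed, hv, bitValue]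
    · rw [map_pointIndicator, aeval_axiom_ipsEmbed, hv, bitValue]
  · intro f hf
    rcases aeval_mem_cnfEncoding hf with ⟨Q, hQ, _, ⟨v₁, rfl⟩, _, ⟨v₂, rfl⟩, h⟩ | ⟨j, h⟩ |
      ⟨j, a, ha, h⟩
    · obtain ⟨p, hp, hp0, hpf⟩ := hTQ Q hQ v₁ v₂
      exact ⟨p, Or.inl (Or.inr (Or.inr hp)), hp0, by rw [hpf, h]⟩
    · refine ⟨_, Or.inr ⟨j, 0, Or.inr rfl⟩, ?_, ?_⟩
      · rw [map_sub, aeval_zero_pointIndicator_y, map_one, pointIndicator_zero_zero, sub_self]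
      · rw [h, map_sub, aeval_axiom_pointIndicator_y, map_one]
    · refine ⟨_, Or.inr ⟨j, a, Or.inl rfl⟩, ?_, ?_⟩
      · rw [aeval_zero_pointIndicator_y, pointIndicator_zero_of_ne ha]
      · rw [h, aeval_axiom_pointIndicator_y]
  · intro b
    obtain ⟨v, hv⟩ := wireValue_mem_range C b.1
    obtain ⟨p, hp, hp0, hpf⟩ := hTQ _ (booleanAxiom_mem b.2) v v
    refine ⟨p, Or.inl (Or.inr (Or.inr hp)), hp0, ?_⟩
    rw [hpf, hv, aeval_boolean_eq]

end Substitution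

/-! ### Translation of refutations -/

section Translation

theorem HasIPSRefutation.mono {F X ι : Type*} [CommRing F] {f : ι → MvPolynomial X F}
    {S S' D D' : ℕ} (h : HasIPSRefutation f S D) (hS : S ≤ S') (hD : D ≤ D') :
    HasIPSRefutation f S' D' := by
  obtain ⟨R, hR, h1, h2⟩ := h
  exact ⟨R, hR, h1.trans hS, h2.trans hD⟩

/-- IPS refutations are stable under substitutions for which the substituted variables and the
derivations of the substituted axioms are computable. -/
theorem HasIPSRefutation.substitute {F X' ι' : Type*} {X ι : Type*} [CommRing F]
    {f : ι → MvPolynomial X F} {f' : ι' → MvPolynomial X' F} {σ : X' → MvPolynomial X F}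
    {T : Set (MvPolynomial (IPSVar X ι) F)} {N d S D : ℕ}
    (hT : Computes (Set.range MvPolynomial.X) N d T)
    (hx : ∀ v, ∃ p ∈ T, aeval (ipsZeroSubst (F := F)) p = σ v ∧
      aeval (ipsAxiomSubst f) p = σ v)
    (hy : ∀ j, ∃ p ∈ T, aeval (ipsZeroSubst (F := F)) p = 0 ∧
      aeval (ipsAxiomSubst f) p = aeval σ (f' j))
    (hz : ∀ v, ∃ p ∈ T, aeval (ipsZeroSubst (F := F)) p = 0 ∧
      aeval (ipsAxiomSubst f) p = σ v ^ 2 - σ v)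
    (h : HasIPSRefutation f' S D) : HasIPSRefutation f (N + S) (d + 1 + D) := by
  obtain ⟨R, ⟨hR0, hR1⟩, hS, hD⟩ := h
  choose θx hxT hx0 hx1 using hx
  choose θy hyT hy0 hy1 using hy
  choose θz hzT hz0 hz1 using hz
  let θ : IPSVar X' ι' → MvPolynomial (IPSVar X ι) F
    | .x v => θx v
    | .y j => θy j
    | .z v => θz v
  have hθ : ∀ v, θ v ∈ T := by
    rintro (v | j | v)
    exacts [hxT v, hyT j, hzT v]
  have hR := (R.computes.map (aeval θ)).mono (B' := T) (T' := {aeval θ R.poly}) (by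
    rintro _ ⟨_, ⟨g, x, -, rfl⟩, rfl⟩
    rw [aeval_X]
    exact hθ x) hS hD (by
    rw [Set.singleton_subset_iff]
    exact Set.mem_image_of_mem _ (Set.mem_range_self R.out))
  obtain ⟨R', hpoly, hsize, hdepth⟩ :=
    ((hT.comp hR).mono subset_rfl le_rfl le_rfl Set.subset_union_right).exists_circuit
  refine ⟨R', ⟨?_, ?_⟩, hsize, hdepth⟩
  -- On each variable, `θ` followed by zeroing the placeholders agrees with zeroing followed by `σ`;
  -- likewise below for inserting the axioms. So both conditions on `R` carry over.
  · have key : (aeval (ipsZeroSubst (F := F))).comp (aeval θ) =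
        (aeval σ).comp (aeval (ipsZeroSubst (F := F) (X := X') (ι := ι'))) := by
      ext v : 1
      rcases v with v | j | v <;> simp [θ, ipsZeroSubst, hx0, hy0, hz0, -aeval_eq_bind₁]
    rw [hpoly, ← AlgHom.comp_apply, key, AlgHom.comp_apply, hR0, map_zero]
  · have key : (aeval (ipsAxiomSubst f)).comp (aeval θ) =
        (aeval σ).comp (aeval (ipsAxiomSubst f')) := by
      ext v : 1
      rcases v with v | j | v <;> simp [θ, ipsAxiomSubst, hx1, hy1, hz1, -aeval_eq_bind₁]
    rw [hpoly, ← AlgHom.comp_apply, key, AlgHom.comp_apply, hR1, map_one]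

end Translation

/-! ### Transfer of hardness to the CNF encoding -/

theorem mainTheorem5 (F : Type*) [Field F] [Fintype F] :
    ∃ (c : ℕ) (p : Polynomial ℕ),
      (∀ (φ : TableCNF F) (m n : ℕ) (C : Fin m → AlgCircuit F (Fin n)) (Δ S D : ℕ),
        1 ≤ Δ → (∀ j, (C j).depth ≤ Δ) →
        ¬ HasIPSRefutation (fun j => (C j).poly) S (D + c * Δ) →
        ¬ HasIPSRefutation (fun f : cnfEncoding φ C => f.1)
            (S - p.eval (∑ j, (C j).size)) D) ∧
      (∀ b k : ℕ, ∃ a : ℕ,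
        ∀ (φ : TableCNF F) (m n : ℕ) (C : Fin m → AlgCircuit F (Fin n)) (Δ Δ' S : ℕ),
        1 ≤ Δ' → Δ ≤ k * Δ' → (∀ j, (C j).depth ≤ Δ) →
        ¬ HasIPSRefutation (fun j => (C j).poly) S (a * Δ') →
        ¬ HasIPSRefutation (fun f : cnfEncoding φ C => f.1)
            (S - p.eval (∑ j, (C j).size)) (b * (Δ' + Δ))) := by
  obtain ⟨c, P, h⟩ := exists_computes_substitution F
  have key (φ : TableCNF F) (m n : ℕ) (C : Fin m → AlgCircuit F (Fin n)) (Δ S D : ℕ)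
      (hΔ : ∀ j, (C j).depth ≤ Δ)
      (hR : HasIPSRefutation (fun f : cnfEncoding φ C => f.1)
        (S - P.eval (∑ j, (C j).size)) D) :
      HasIPSRefutation (fun j => (C j).poly) S (Δ + c + 1 + D) := by
    obtain ⟨T, hT, hx, hy, hz⟩ := h φ m n C Δ hΔ
    -- A refutation has at least one node, so the subtraction is not truncated and the two sizes add
    -- up to `S`.
    have hpos : 0 < S - P.eval (∑ j, (C j).size) := by
      obtain ⟨R, -, hS, -⟩ := hR
      exact (Fin.pos R.out).trans_le hS
    have hy' (f : cnfEncoding φ C) := hy f.1 f.2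
    have h1 := HasIPSRefutation.substitute hT hx hy' hz hR
    refine h1.mono ?_ le_rfl
    omega
  -- Since `Δ ≥ 1`, the extra depth `Δ + c + 1` is at most `(c + 2) * Δ`.
  refine ⟨c + 2, P, fun φ m n C Δ S D h1 hΔ hC hR => hC ?_, fun b k => ?_⟩
  · refine (key φ m n C Δ S D hΔ hR).mono le_rfl ?_
    nlinarith
  -- The summands absorb `Δ ≤ k * Δ'`, the constant `c + 1` (as `Δ' ≥ 1`) and `b * (Δ' + Δ)`.
  · refine ⟨k + c + 1 + b * (1 + k), fun φ m n C Δ Δ' S h1 hk hΔ hC hR => hC ?_⟩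
    refine (key φ m n C Δ S _ hΔ hR).mono le_rfl ?_
    have h2 : b * (Δ' + Δ) ≤ b * (1 + k) * Δ' := by
      rw [mul_assoc]
      exact Nat.mul_le_mul_left b (by linarith)
    nlinarith
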